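/- **Conventions.** Let $n\ge 3$. Let $\mathbb K$ be a division ring (a field whenever $D_n$ is concerned) and $\mathbb K_0$ a proper sub-division ring of $\mathbb K$. *The geometry $A_n(\mathbb K)$.* Let $V$ be a vector space over $\mathbb K$ of dimension $n+1$ with a fixed basis $E$. For $1\le i\le n$ the elements of type $i$ of $A_n(\mathbb K)$ are the $i$-dimensional subspaces of $V$; incidence is symmetrized inclusion. The diagram $A_n$ is the path $1,2,\dots,n$. *The geometry $D_n(\mathbb K)$.* Let $V$ be a vector space over $\mathbb K$ of dimension $2n$ with a basis $E=(e_1,\dots,e_{2n})$, and $q$ the quadratic form with expression $q(x)=x_1x_2+x_3x_4+\dots+x_{2n-1}x_{2n}$ in that basis. For $1\le i\le n-2$ the elements of type $i$ of $D_n(\mathbb K)$ are the $i$-dimensional totally singular subspaces. The relation "$X\cap Y$ has even codimension in $X$" is an equivalence relation with two classes on the set of $n$-dimensional totally singular subspaces; the members of one class (either one) are the elements of type $+$, those of the other class the elements of type $-$. An element $X$ of type $+$ and an element $Y$ of type $-$ are incident when $\dim(X\cap Y)=n-1$; in all other cases incidence is symmetrized inclusion. In the diagram $D_n$ the nodes $1,\dots,n-2$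 form a path and each of $+$, $-$ is joined to $n-2$ only. *Grassmannians.* Let $\Delta$ be $A_n(\mathbb K)$ or $D_n(\mathbb K)$ and $J$ a set of types. A $J$-flag is a set of pairwise incident elements containing exactly one element of each type in $J$ and no others. The points of $\mathrm{Gr}_J(\Delta)$ are the $J$-flags; its lines are the flags of type $(J\setminus\{j\})\cup\mathrm{fr}(j)$ for $j\in J$, where $\mathrm{fr}(j)$ is the set of nodes adjacent to $j$ in the diagram; a point and a line are incident when their union is a flag. A set of points is a subspace if it contains every point of every line having at least two distinct points in it; it is proper if it is not the set of all points. *Rationality.* A subspace of $V$ is $\mathbb K_0$-rational if it has a basis consisting of vectors whose coordinates with respect to $E$ lie in $\mathbb K_0$. A node $t$ splits $J$ if $t\notin J$ and $J$ is not contained in a single connected component of the diagram with $t$ removed. A $J$-flag $F$ is nearly $\mathbb K_0$-rational if at least one of its elements is $\mathbb K_0$-rational or there is a $\mathbb K_0$-rational element of $\Delta$ which is incident with (every element of) $F$ and whose type splits $J$. For $\Gamma(\mathbb K)=\mathrm{Gr}_J(\Delta)$ let $\Omega_{\mathbb K_0}(\Gamma(\mathbb K))$ be the set of nearly $\mathbb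 K_0$-rational points. **Theorem 3.3.** If $\Gamma(\mathbb K)$ is $\mathrm{Gr}_{1,n}(A_n(\mathbb K))$, $\mathrm{Gr}_{1,-}(D_n(\mathbb K))$, $\mathrm{Gr}_{1,+,-}(D_n(\mathbb K))$ or $\mathrm{Gr}_{+,-}(D_n(\mathbb K))$, then $\Omega_{\mathbb K_0}(\Gamma(\mathbb K))$ is a proper subspace of $\Gamma(\mathbb K)$. -/

import Mathlib

universe u v

/-! ### Point-line geometries -/

/-- A point-line geometry: points, lines and an incidence relation between them. -/
structure PointLineGeometry where
  Point : Type*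
  Line : Type*
  Inc : Point → Line → Prop

/-- A set `S` of points is a subspace if it contains all points of every line that has (at least)
two distinct points in `S`. -/
def PointLineGeometry.IsSubspace (Γ : PointLineGeometry) (S : Set Γ.Point) : Prop :=
  ∀ (l : Γ.Line) (p p' : Γ.Point), p ≠ p' → p ∈ S → p' ∈ S → Γ.Inc p l → Γ.Inc p' l →
    ∀ r : Γ.Point, Γ.Inc r l → r ∈ S

/-- A subspace different from the whole set of points. -/
def PointLineGeometry.IsProperSubspace (Γ : PointLineGeometry) (S : Set Γ.Point) : Prop :=
  Γ.IsSubspace S ∧ S ≠ Set.univ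

/-! ### Geometries of vector subspaces, flags and Grassmannians -/

/-- A geometry over the type set `I`, with a diagram on `I`, whose elements of type `i` are certain
vector subspaces of `V`. `Inc i j X Y` says that `X`, of type `i`, and `Y`, of type `j`,
are incident. -/
structure SubspaceGeometry (K : Type*) (V : Type*) [DivisionRing K] [AddCommGroup V] [Module K V]
    (I : Type*) where
  diagram : SimpleGraph I
  IsElem : I → Submodule K V → Prop
  Inc : I → I → Submodule K V → Submodule K V → Prop
  inc_symm : ∀ {i j : I} {X Y : Submodule K V}, Inc i j X Y → Inc j i Y X
  inc_self : ∀ {i : I} {X Y : Submodule K V}, IsElem i X → IsElem i Y → (Inc i i X Y ↔ X = Y)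

namespace SubspaceGeometry

variable {K : Type*} {V : Type*} [DivisionRing K] [AddCommGroup V] [Module K V] {I : Type*}

/-- A flag of type `J`: one element of each type `j ∈ J`, any two of them incident. -/
@[ext]
structure Flag (Δ : SubspaceGeometry K V I) (J : Set I) where
  elem : J → Submodule K V
  isElem : ∀ j : J, Δ.IsElem j (elem j)
  inc : ∀ i j : J, Δ.Inc i j (elem i) (elem j)

/-- Two flags are incident if their union is a flag, that is, if every element of the first is
incident with every element of the second (elements of the same type being incident only when they
are equal). -/
def Flag.Incident {Δ : SubspaceGeometry K V I} {J J' : Set I} (F : Δ.Flag J) (L : Δ.Flag J') :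
    Prop :=
  ∀ (i : J) (j : J'), Δ.Inc i j (F.elem i) (L.elem j)

/-- The `J`-Grassmannian. Its points are the flags of type `J`. Its lines are the flags of type
`(J \ {j}) ∪ fr(j)` for `j ∈ J`, where `fr(j)` is the set of types adjacent to `j` in the diagram.
Incidence is incidence of flags. -/
def Gr (Δ : SubspaceGeometry K V I) (J : Set I) : PointLineGeometry where
  Point := Δ.Flag J
  Line := Σ j : J, Δ.Flag ((J \ {(j : I)}) ∪ Δ.diagram.neighborSet (j : I))
  Inc F l := F.Incident l.2

/-- The node `t` splits `J`: it is not in `J`, and `J` is not contained in one single connected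
component of the graph obtained from the diagram by removing the node `t`. -/
def Splits (Δ : SubspaceGeometry K V I) (t : I) (J : Set I) : Prop :=
  t ∉ J ∧ ¬ ∃ C : (Δ.diagram.induce {t}ᶜ).ConnectedComponent, J ⊆ Subtype.val '' C.supp

end SubspaceGeometry

/-! ### Rationality -/

section Rational

variable {K : Type*} {V : Type*} [DivisionRing K] [AddCommGroup V] [Module K V] {ι : Type*}

/-- A vector is `K₀`-rational with respect to the basis `E` if its coordinates are in `K₀`. -/
def IsRationalVector (E : Module.Basis ι K V) (K₀ : Subfield K) (v : V) : Prop :=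
  ∀ i, E.repr v i ∈ K₀

/-- A subspace is `K₀`-rational with respect to `E` if it has a basis of `K₀`-rational vectors. -/
def IsRationalSubspace (E : Module.Basis ι K V) (K₀ : Subfield K) (X : Submodule K V) : Prop :=
  ∃ s : Set V, (∀ x ∈ s, IsRationalVector E K₀ x) ∧ LinearIndepOn K id s ∧
    Submodule.span K s = X

/-- A `J`-flag is nearly `K₀`-rational if one of its elements is `K₀`-rational or it is incident
with a `K₀`-rational element whose type splits `J`. -/
def SubspaceGeometry.IsNearlyRational {I : Type*} (Δ : SubspaceGeometry K V I)
    (E : Module.Basis ι K V) (K₀ : Subfield K) {J : Set I} (F : Δ.Flag J) : Prop :=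
  (∃ j : J, IsRationalSubspace E K₀ (F.elem j)) ∨
    ∃ (t : I) (X : Submodule K V), Δ.Splits t J ∧ Δ.IsElem t X ∧ IsRationalSubspace E K₀ X ∧
      ∀ j : J, Δ.Inc t j X (F.elem j)

/-- The set of nearly `K₀`-rational points of the `J`-Grassmannian. -/
def SubspaceGeometry.Omega {I : Type*} (Δ : SubspaceGeometry K V I)
    (E : Module.Basis ι K V) (K₀ : Subfield K) (J : Set I) : Set (Δ.Gr J).Point :=
  {F : Δ.Flag J | Δ.IsNearlyRational E K₀ F}

end Rational

theorem subspace_comparable_iff_eq {K V : Type*} [DivisionRing K] [AddCommGroup V] [Module K V]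
    {d : ℕ} (hd : 0 < d) {X Y : Submodule K V} (hX : Module.finrank K X = d)
    (hY : Module.finrank K Y = d) : (X ≤ Y ∨ Y ≤ X) ↔ X = Y := by
  have : FiniteDimensional K X := FiniteDimensional.of_finrank_pos (by omega)
  have : FiniteDimensional K Y := FiniteDimensional.of_finrank_pos (by omega)
  constructor
  · rintro (h | h)
    · exact Submodule.eq_of_le_of_finrank_eq h (by omega)
    · exact (Submodule.eq_of_le_of_finrank_eq h (by omega)).symm
  · rintro rfl
    exact Or.inl le_rfl

/-! ### The geometry of type `A_n` -/

/-- The geometry `A_n(K)` of the vector space `V` of dimension `n + 1`. The types are the nodes of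
the path with `n` nodes, with the type of dimension `d` (`1 ≤ d ≤ n`) written as `d - 1 : Fin n`.
The elements are the subspaces of dimension `1, ..., n`; incidence is symmetrized inclusion. -/
def geometryA (K : Type*) (V : Type*) [DivisionRing K] [AddCommGroup V] [Module K V] (n : ℕ) :
    SubspaceGeometry K V (Fin n) where
  diagram := SimpleGraph.pathGraph n
  IsElem i X := Module.finrank K X = (i : ℕ) + 1
  Inc _ _ X Y := X ≤ Y ∨ Y ≤ X
  inc_symm h := h.symm
  inc_self hX hY := subspace_comparable_iff_eq (Nat.succ_pos _) hX hY

/-- The set of types `{1, n}` of `A_n`. -/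
def typesA {n : ℕ} (hn : 3 ≤ n) : Set (Fin n) :=
  {⟨0, by omega⟩, ⟨n - 1, by omega⟩}

/-! ### The geometry of type `D_n` -/

/-- The nodes `1, ..., n - 2, +, -` of the diagram `D_n`; `low i` is the node `i + 1`. -/
inductive DNode (n : ℕ) : Type
  | low (i : Fin (n - 2)) : DNode n
  | plus : DNode n
  | minus : DNode n

/-- Adjacency of nodes in the diagram `D_n`: the nodes `1, ..., n - 2` form a path, and `+` and `-`
are both joined to `n - 2` and to no other node. -/
def DNode.Adj {n : ℕ} : DNode n → DNode n → Prop
  | .low i, .low j => (i : ℕ) + 1 = j ∨ (j : ℕ) + 1 = i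
  | .low i, .plus => (i : ℕ) + 1 = n - 2
  | .low i, .minus => (i : ℕ) + 1 = n - 2
  | .plus, .low i => (i : ℕ) + 1 = n - 2
  | .minus, .low i => (i : ℕ) + 1 = n - 2
  | .plus, .plus => False
  | .plus, .minus => False
  | .minus, .plus => False
  | .minus, .minus => False

/-- The diagram `D_n`. -/
def diagramD (n : ℕ) : SimpleGraph (DNode n) where
  Adj := DNode.Adj
  symm := ⟨fun s t h => by cases s <;> cases t <;> simp_all [DNode.Adj, or_comm]⟩
  loopless := ⟨fun s h => by cases s <;> simp [DNode.Adj] at h⟩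

section TypeD

variable {K : Type*} {V : Type*} [Field K] [AddCommGroup V] [Module K V]

/-- A subspace is totally singular for `q` if `q` vanishes on it. -/
def IsTotallySingular (q : QuadraticForm K V) (X : Submodule K V) : Prop :=
  ∀ x ∈ X, q x = 0

/-- The relation `X ∼ Y` on totally singular subspaces of dimension `n`:
the intersection `X ∩ Y` has even codimension in `X`. -/
def SameFamily (X Y : Submodule K V) : Prop :=
  Even (Module.finrank K X - Module.finrank K (X ⊓ Y : Submodule K V))

/-- The elements of each type of `D_n(K)`: for `1 ≤ d ≤ n - 2`, those of type `d` are the totally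
singular subspaces of dimension `d`. The totally singular subspaces of dimension `n` form two
families, the classes of the relation `∼`; those in the family of `M₀` have type `+`, those
in the other family have type `-`. -/
def IsElemD (q : QuadraticForm K V) (n : ℕ) (M₀ : Submodule K V) :
    DNode n → Submodule K V → Prop
  | .low i, X => IsTotallySingular q X ∧ Module.finrank K X = (i : ℕ) + 1
  | .plus, X => IsTotallySingular q X ∧ Module.finrank K X = n ∧ SameFamily X M₀
  | .minus, X => IsTotallySingular q X ∧ Module.finrank K X = n ∧ ¬ SameFamily X M₀

/-- Incidence in `D_n(K)`: an element of type `+` and one of type `-` are incident when their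
intersection has dimension `n - 1`; in all other cases incidence is symmetrized inclusion. -/
def IncD (n : ℕ) : DNode n → DNode n → Submodule K V → Submodule K V → Prop
  | .plus, .minus, X, Y => Module.finrank K (X ⊓ Y : Submodule K V) = n - 1
  | .minus, .plus, X, Y => Module.finrank K (X ⊓ Y : Submodule K V) = n - 1
  | .low _, _, X, Y => X ≤ Y ∨ Y ≤ X
  | .plus, .low _, X, Y => X ≤ Y ∨ Y ≤ X
  | .minus, .low _, X, Y => X ≤ Y ∨ Y ≤ X
  | .plus, .plus, X, Y => X ≤ Y ∨ Y ≤ X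
  | .minus, .minus, X, Y => X ≤ Y ∨ Y ≤ X

/-- The geometry `D_n(K)` of the quadratic form `q` of Witt index `n` on the `2 n`-dimensional space
`V`, where `M₀` is a totally singular subspace of dimension `n` that fixes which of the two families
gets the type `+`. -/
def geometryD {n : ℕ} (hn : 3 ≤ n) (q : QuadraticForm K V) (M₀ : Submodule K V) :
    SubspaceGeometry K V (DNode n) where
  diagram := diagramD n
  IsElem := IsElemD q n M₀
  Inc := IncD n
  inc_symm {s t X Y} h := by
    cases s <;> cases t <;> simp only [IncD] at h ⊢ <;>
      first
        | exact h.symm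
        | (rw [inf_comm]; exact h)
  inc_self {s X Y} hX hY := by
    cases s
    · exact subspace_comparable_iff_eq (Nat.succ_pos _) hX.2 hY.2
    · exact subspace_comparable_iff_eq (by omega) hX.2.1 hY.2.1
    · exact subspace_comparable_iff_eq (by omega) hX.2.1 hY.2.1

/-- The form `q` has the expression `x₁ x₂ + x₃ x₄ + ... + x₂ₙ₋₁ x₂ₙ` in the basis `E`, the basis
vectors `e₂ᵢ₋₁`, `e₂ᵢ` being written as `E (i, 0)`, `E (i, 1)`. -/
def HasCanonicalForm {n : ℕ} (q : QuadraticForm K V) (E : Module.Basis (Fin n × Fin 2) K V) :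
    Prop :=
  ∀ x : V, q x = ∑ i : Fin n, E.repr x (i, 0) * E.repr x (i, 1)

end TypeD

/-- The type `1` of `D_n`. -/
def DNode.one {n : ℕ} (hn : 3 ≤ n) : DNode n := .low ⟨0, by omega⟩

/-! ### Rational subspaces -/

section RationalSubspaces

variable {K : Type u} {V : Type*} [DivisionRing K] [AddCommGroup V] [Module K V] {ι : Type*}
  {E : Module.Basis ι K V} {K₀ : Subfield K}

/-! Rational subspaces are closed under sums, under intersections and, for `D_n`, under polar
orthogonals. Sums are immediate. The other two rest on a basis-free criterion: a subspace is
rational exactly when it is stable under applying to coordinates every additive map of `K` that is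
linear for right multiplication by `K₀` (`IsRationalSubspace.coordMap_mem`,
`isRationalSubspace_of_coordMap_mem`).

Near rationality of a flag becomes the existence of a rational `X` squeezed between its elements;
for `{1,+,-}` and `{+,-}` a rational maximal element is the alternative. Two points of a line differ
in one element only. If the element of dimension 1 varies, those of two distinct points span a plane
containing all the others, so `X ⊔ X'` serves every point of the line. If the other end varies, two
such elements intersect in a subspace common to the whole line, so `X ⊓ X'` serves.

Type `D_n` adds two difficulties. Dimension `n - 1` is not a type, but a maximal totally singular
subspace with a rational hyperplane is itself rational
(`HasCanonicalForm.isRationalSubspace_of_le`): the hyperplane lies in only two maximal ones, and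
rational ones can be built for both. For `{+,-}` only the node `n - 2` splits, so `X` has prescribed
dimension and `X ⊓ X'` may be too small; `HasCanonicalForm.isRational_or_le` shows that otherwise
the unchanged maximal element is rational.

For properness, take `a ∉ K₀` and a flag through the line spanned by `e + a • e'`, whose large
elements impose relations with factor `a`. These force the `e`-coordinate of each of their rational
vectors to vanish, so no rational subspace fits in between. -/

theorem isRationalSubspace_span {s : Set V} (hs : ∀ x ∈ s, IsRationalVector E K₀ x) :
    IsRationalSubspace E K₀ (Submodule.span K s) := by
  obtain ⟨b, hb, hspan, hli⟩ := exists_linearIndependent K s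
  exact ⟨b, fun x hx => hs x (hb hx), hli, hspan⟩

theorem IsRationalSubspace.sup {X Y : Submodule K V} (hX : IsRationalSubspace E K₀ X)
    (hY : IsRationalSubspace E K₀ Y) : IsRationalSubspace E K₀ (X ⊔ Y) := by
  obtain ⟨s, hs, -, rfl⟩ := hX
  obtain ⟨t, ht, -, rfl⟩ := hY
  rw [← Submodule.span_union]
  exact isRationalSubspace_span fun x hx => hx.elim (hs x) (ht x)

/-- To include a rational subspace it suffices to include its rational vectors. -/
theorem IsRationalSubspace.le_of_forall {X Y : Submodule K V} (hX : IsRationalSubspace E K₀ X)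
    (h : ∀ x ∈ X, IsRationalVector E K₀ x → x ∈ Y) : X ≤ Y := by
  obtain ⟨s, hs, -, rfl⟩ := hX
  exact Submodule.span_le.2 fun x hx => h x (Submodule.subset_span hx) (hs x hx)

theorem isRationalVector_basis (i : ι) : IsRationalVector E K₀ (E i) := by
  classical
  intro j
  rw [E.repr_self, Finsupp.single_apply]
  split_ifs
  · exact K₀.one_mem
  · exact K₀.zero_mem

/-- An additive map of `K` that is linear for the right action of `K₀`. -/
def IsRightLinear (K₀ : Subfield K) (f : K →+ K) : Prop :=
  ∀ x, ∀ c ∈ K₀, f (x * c) = f x * c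

variable [Fintype ι]

/-- The additive map that applies `f` to the coordinates. -/
noncomputable def coordMap (E : Module.Basis ι K V) (f : K →+ K) (x : V) : V :=
  ∑ i, f (E.repr x i) • E i

theorem repr_coordMap (f : K →+ K) (x : V) (i : ι) :
    E.repr (coordMap E f x) i = f (E.repr x i) := by
  classical
  simp [coordMap, Finsupp.single_apply]

theorem coordMap_zero (f : K →+ K) : coordMap E f 0 = 0 := by
  simp [coordMap]

theorem coordMap_add (f : K →+ K) (x y : V) :
    coordMap E f (x + y) = coordMap E f x + coordMap E f y := by
  simp [coordMap, add_smul, Finset.sum_add_distrib]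

theorem coordMap_smul (f : K →+ K) (k : K) (x : V) :
    coordMap E f (k • x) = coordMap E (f.comp (AddMonoidHom.mulLeft k)) x := by
  simp [coordMap]

/-- Right linearity gives `f c = f 1 * c` for `c ∈ K₀`, so `f` acts on all coordinates as one left
scalar. -/
theorem coordMap_of_isRationalVector {f : K →+ K} (hf : IsRightLinear K₀ f) {x : V}
    (hx : IsRationalVector E K₀ x) : coordMap E f x = f 1 • x := by
  conv_rhs => rw [← E.sum_repr x]
  rw [coordMap, Finset.smul_sum]
  refine Finset.sum_congr rfl fun i _ => ?_
  rw [smul_smul, ← hf 1 _ (hx i), one_mul]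

/-- `coordMap` is not `K`-linear, so `f` has to vary in the induction: a scalar `k` is absorbed by
replacing `f` with its composite with left multiplication by `k`, which is again right linear. -/
theorem IsRationalSubspace.coordMap_mem {X : Submodule K V} (hX : IsRationalSubspace E K₀ X)
    {f : K →+ K} (hf : IsRightLinear K₀ f) {x : V} (hx : x ∈ X) : coordMap E f x ∈ X := by
  obtain ⟨s, hs, -, rfl⟩ := hX
  induction hx using Submodule.span_induction generalizing f with
  | mem x hx =>
    rw [coordMap_of_isRationalVector hf (hs x hx)]
    exact Submodule.smul_mem _ _ (Submodule.subset_span hx)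
  | zero => rw [coordMap_zero]; exact Submodule.zero_mem _
  | add x y _ _ hx hy => rw [coordMap_add]; exact Submodule.add_mem _ (hx hf) (hy hf)
  | smul k x _ hx =>
    rw [coordMap_smul]
    refine hx fun y c hc => ?_
    simp [← mul_assoc, hf _ c hc]

/-- The `f k` are the coordinate functions of a basis `b` of `K` as a right vector space over `K₀`.
Finitely many of them suffice for the finite family `x`: `T` is the union of the supports. -/
theorem exists_sum_mul_rightLinear (K₀ : Subfield K) (x : ι → K) :
    ∃ (κ : Type u) (T : Finset κ) (b : κ → K) (f : κ → K →+ K),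
      (∀ k, IsRightLinear K₀ (f k) ∧ ∀ y, f k y ∈ K₀) ∧ ∀ i, x i = ∑ k ∈ T, b k * f k (x i) := by
  classical
  let : Module K₀ᵐᵒᵖ K := Module.compHom K (RingHom.op K₀.subtype)
  have smul_def : ∀ (c : K₀ᵐᵒᵖ) (y : K), c • y = y * (c.unop : K) := fun c y => rfl
  let b := Module.Basis.ofVectorSpace K₀ᵐᵒᵖ K
  refine ⟨Module.Basis.ofVectorSpaceIndex K₀ᵐᵒᵖ K, Finset.univ.biUnion fun i => (b.repr (x i)).support, b,
    fun k => ⟨⟨fun y => ((b.repr y k).unop : K), by simp⟩, by simp⟩, fun k => ⟨?_, ?_⟩, ?_⟩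
  · intro y c hc
    have := smul_def (MulOpposite.op ⟨c, hc⟩) y
    simp only [MulOpposite.unop_op] at this
    simp only [AddMonoidHom.coe_mk, ZeroHom.coe_mk, ← this, map_smul]
    simp
  · intro y
    simp
  · intro i
    conv_lhs => rw [← b.linearCombination_repr (x i)]
    rw [Finsupp.linearCombination_apply, Finsupp.sum]
    refine Finset.sum_subset (Finset.subset_biUnion_of_mem (fun i => (b.repr (x i)).support)
      (Finset.mem_univ i)) fun k _ hk => ?_
    rw [Finsupp.notMem_support_iff.1 hk, zero_smul]

/-- Expanding the coordinates of `x` over `K₀` writes `x` as a `K`-combination of the vectors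
`coordMap E (f k) x`. These are rational, and by stability they lie in `X`. -/
theorem isRationalSubspace_of_coordMap_mem {X : Submodule K V}
    (h : ∀ f : K →+ K, IsRightLinear K₀ f → (∀ y, f y ∈ K₀) → ∀ x ∈ X, coordMap E f x ∈ X) :
    IsRationalSubspace E K₀ X := by
  have : Submodule.span K {x | x ∈ X ∧ IsRationalVector E K₀ x} = X := by
    refine le_antisymm (Submodule.span_le.2 fun x hx => hx.1) fun x hx => ?_
    obtain ⟨κ, T, b, f, hf, hsum⟩ := exists_sum_mul_rightLinear K₀ fun i => E.repr x i
    have hx' : x = ∑ k ∈ T, b k • coordMap E (f k) x := by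
      refine E.ext_elem fun i => ?_
      rw [map_sum, Finsupp.finsetSum_apply]
      simp only [map_smul, Finsupp.smul_apply, repr_coordMap, smul_eq_mul]
      exact hsum i
    rw [hx']
    refine Submodule.sum_mem _ fun k _ => Submodule.smul_mem _ _ (Submodule.subset_span
      ⟨h _ (hf k).1 (hf k).2 x hx, fun i => ?_⟩)
    rw [repr_coordMap]
    exact (hf k).2 _
  rw [← this]
  exact isRationalSubspace_span fun x hx => hx.2

theorem IsRationalSubspace.inf {X Y : Submodule K V} (hX : IsRationalSubspace E K₀ X)
    (hY : IsRationalSubspace E K₀ Y) : IsRationalSubspace E K₀ (X ⊓ Y) :=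
  isRationalSubspace_of_coordMap_mem fun _ hf _ _ hx =>
    ⟨hX.coordMap_mem hf hx.1, hY.coordMap_mem hf hx.2⟩

end RationalSubspaces

/-! ### Totally singular subspaces -/

section TotallySingular

variable {K : Type u} {V : Type*} [Field K] [AddCommGroup V] [Module K V]
  {q : QuadraticForm K V} {n : ℕ} {E : Module.Basis (Fin n × Fin 2) K V}

theorem HasCanonicalForm.polar_eq (hq : HasCanonicalForm q E) (x y : V) :
    QuadraticMap.polar q x y =
      ∑ i, (E.repr x (i, 0) * E.repr y (i, 1) + E.repr x (i, 1) * E.repr y (i, 0)) := by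
  rw [QuadraticMap.polar, hq, hq, hq, ← Finset.sum_sub_distrib, ← Finset.sum_sub_distrib]
  refine Finset.sum_congr rfl fun i _ => ?_
  simp only [map_add, Finsupp.add_apply]
  ring

theorem HasCanonicalForm.polar_basis_one (hq : HasCanonicalForm q E) (x : V) (i : Fin n) :
    QuadraticMap.polar q x (E (i, 1)) = E.repr x (i, 0) := by
  classical
  simp [hq.polar_eq, Finsupp.single_apply]

theorem HasCanonicalForm.polar_basis_zero (hq : HasCanonicalForm q E) (x : V) (i : Fin n) :
    QuadraticMap.polar q x (E (i, 0)) = E.repr x (i, 1) := by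
  classical
  simp [hq.polar_eq, Finsupp.single_apply]

theorem HasCanonicalForm.nondegenerate (hq : HasCanonicalForm q E) :
    LinearMap.BilinForm.Nondegenerate q.polarBilin := by
  have key : ∀ x : V, (∀ y, QuadraticMap.polar q x y = 0) → x = 0 := by
    intro x hx
    refine E.ext_elem fun ⟨i, j⟩ => ?_
    rw [map_zero, Finsupp.zero_apply]
    fin_cases j
    · exact (hq.polar_basis_one x i).symm.trans (hx _)
    · exact (hq.polar_basis_zero x i).symm.trans (hx _)
  exact ⟨fun x hx => key x hx, fun x hx => key x fun y =>
    (QuadraticMap.polar_comm q x y).trans (hx y)⟩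

/-- The subspace orthogonal to `X` for the polar form of `q`. -/
def polarPerp (q : QuadraticForm K V) (X : Submodule K V) : Submodule K V :=
  LinearMap.BilinForm.orthogonal q.polarBilin X

theorem mem_polarPerp {X : Submodule K V} {y : V} :
    y ∈ polarPerp q X ↔ ∀ x ∈ X, QuadraticMap.polar q x y = 0 :=
  LinearMap.BilinForm.mem_orthogonal_iff

theorem polarPerp_anti {X Y : Submodule K V} (h : X ≤ Y) : polarPerp q Y ≤ polarPerp q X :=
  fun _ hy => mem_polarPerp.2 fun x hx => mem_polarPerp.1 hy x (h hx)

theorem polarPerp_sup (X Y : Submodule K V) :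
    polarPerp q (X ⊔ Y) = polarPerp q X ⊓ polarPerp q Y := by
  refine le_antisymm (le_inf (polarPerp_anti le_sup_left) (polarPerp_anti le_sup_right)) ?_
  intro z hz
  refine mem_polarPerp.2 fun w hw => ?_
  obtain ⟨x, hx, y, hy, rfl⟩ := Submodule.mem_sup.1 hw
  rw [QuadraticMap.polar_add_left, mem_polarPerp.1 hz.1 x hx, mem_polarPerp.1 hz.2 y hy, add_zero]

theorem IsTotallySingular.mono {X Y : Submodule K V} (hY : IsTotallySingular q Y) (h : X ≤ Y) :
    IsTotallySingular q X :=
  fun x hx => hY x (h hx)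

theorem IsTotallySingular.polar_eq_zero {X : Submodule K V} (hX : IsTotallySingular q X) {x y : V}
    (hx : x ∈ X) (hy : y ∈ X) : QuadraticMap.polar q x y = 0 := by
  rw [QuadraticMap.polar, hX _ (X.add_mem hx hy), hX x hx, hX y hy, sub_zero, sub_zero]

theorem IsTotallySingular.le_polarPerp {X : Submodule K V} (hX : IsTotallySingular q X) :
    X ≤ polarPerp q X :=
  fun _ hy => mem_polarPerp.2 fun _ hx => hX.polar_eq_zero hx hy

theorem IsTotallySingular.sup {X Y : Submodule K V} (hX : IsTotallySingular q X)
    (hY : IsTotallySingular q Y) (h : Y ≤ polarPerp q X) : IsTotallySingular q (X ⊔ Y) := by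
  intro z hz
  obtain ⟨x, hx, y, hy, rfl⟩ := Submodule.mem_sup.1 hz
  have := mem_polarPerp.1 (h hy) x hx
  rwa [QuadraticMap.polar, hX x hx, hY y hy, sub_zero, sub_zero] at this

theorem isTotallySingular_span_singleton {u : V} (hu : q u = 0) :
    IsTotallySingular q (Submodule.span K {u}) := by
  intro x hx
  obtain ⟨c, rfl⟩ := Submodule.mem_span_singleton.1 hx
  rw [QuadraticMap.map_smul, hu, smul_zero]

theorem finrank_eq_two_mul_of_basis (E : Module.Basis (Fin n × Fin 2) K V) :
    Module.finrank K V = 2 * n := by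
  rw [Module.finrank_eq_card_basis E]
  simp [mul_comm]

theorem HasCanonicalForm.finrank_polarPerp (hq : HasCanonicalForm q E) (X : Submodule K V) :
    Module.finrank K (polarPerp q X) = 2 * n - Module.finrank K X := by
  have := Module.Finite.of_basis E
  rw [polarPerp, LinearMap.BilinForm.finrank_orthogonal hq.nondegenerate,
    finrank_eq_two_mul_of_basis E]

theorem HasCanonicalForm.polarPerp_eq (hq : HasCanonicalForm q E) {M : Submodule K V}
    (hM : IsTotallySingular q M) (hMn : Module.finrank K M = n) : polarPerp q M = M := by
  have := Module.Finite.of_basis E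
  exact (Submodule.eq_of_le_of_finrank_eq hM.le_polarPerp
    (by rw [hq.finrank_polarPerp, hMn]; omega)).symm

/-- As `N` is its own orthogonal, the intersection on the left is the orthogonal of `X ⊔ N`. -/
theorem HasCanonicalForm.finrank_polarPerp_inf (hq : HasCanonicalForm q E) {X N : Submodule K V}
    (hN : IsTotallySingular q N) (hNn : Module.finrank K N = n) :
    Module.finrank K (polarPerp q X ⊓ N : Submodule K V) + Module.finrank K X =
      n + Module.finrank K (X ⊓ N : Submodule K V) := by
  have := Module.Finite.of_basis E
  have h := hq.finrank_polarPerp (X ⊔ N)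
  rw [polarPerp_sup, hq.polarPerp_eq hN hNn] at h
  have h1 := Submodule.finrank_sup_add_finrank_inf_eq X N
  have h2 := Submodule.finrank_le (X ⊔ N)
  rw [finrank_eq_two_mul_of_basis E] at h2
  omega

/-- The totally singular subspace `X + (X^⊥ ∩ N)` is maximal if `N` is. -/
theorem HasCanonicalForm.finrank_sup_polarPerp_inf (hq : HasCanonicalForm q E)
    {X N : Submodule K V} (hX : IsTotallySingular q X)
    (hN : IsTotallySingular q N) (hNn : Module.finrank K N = n) :
    Module.finrank K (X ⊔ (polarPerp q X ⊓ N) : Submodule K V) = n := by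
  have := Module.Finite.of_basis E
  have h := hq.finrank_polarPerp_inf (X := X) hN hNn
  have h1 := Submodule.finrank_sup_add_finrank_inf_eq X (polarPerp q X ⊓ N)
  rw [← inf_assoc, inf_eq_left.2 hX.le_polarPerp] at h1
  omega

theorem IsTotallySingular.sup_polarPerp_inf {X N : Submodule K V} (hX : IsTotallySingular q X)
    (hN : IsTotallySingular q N) : IsTotallySingular q (X ⊔ (polarPerp q X ⊓ N)) :=
  hX.sup (hN.mono inf_le_right) inf_le_left

theorem Submodule.sup_span_singleton_eq_of_finrank [FiniteDimensional K V] {X M : Submodule K V}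
    (hXM : X ≤ M) (hd : Module.finrank K M = Module.finrank K X + 1) {m : V} (hm : m ∈ M)
    (hmX : m ∉ X) : X ⊔ Submodule.span K {m} = M := by
  refine Submodule.eq_of_le_of_finrank_le
    (sup_le hXM ((Submodule.span_singleton_le_iff_mem m M).2 hm)) ?_
  rw [hd]
  exact Submodule.finrank_lt_finrank_of_lt (left_lt_sup.2 fun h =>
    hmX ((Submodule.span_singleton_le_iff_mem m X).1 h))

/-- A totally singular subspace of dimension `n - 1` is in at most two of dimension `n`. -/
theorem HasCanonicalForm.eq_or_eq_of_le (hq : HasCanonicalForm q E) {X M M' M'' : Submodule K V}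
    (hX : Module.finrank K X + 1 = n) (hM : IsTotallySingular q M)
    (hMn : Module.finrank K M = n) (hXM : X ≤ M) (hM' : IsTotallySingular q M')
    (hMn' : Module.finrank K M' = n) (hXM' : X ≤ M') (hM'' : IsTotallySingular q M'')
    (hMn'' : Module.finrank K M'' = n) (hXM'' : X ≤ M'') (hne : M ≠ M') : M'' = M ∨ M'' = M' := by
  have := Module.Finite.of_basis E
  by_contra! hcon
  have aux : ∀ {A B : Submodule K V}, Module.finrank K A = n → Module.finrank K B = n →
      A ≠ B → ∃ a ∈ A, a ∉ B := fun hA hB h =>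
    SetLike.not_le_iff_exists.1 fun hle => h (Submodule.eq_of_le_of_finrank_eq hle (by omega))
  obtain ⟨m, hm, hm'⟩ := aux hMn hMn' hne
  obtain ⟨w, hw, hwM⟩ := aux hMn' hMn hne.symm
  have hMspan := Submodule.sup_span_singleton_eq_of_finrank hXM (by omega) hm fun h => hm' (hXM' h)
  have hMspan' :=
    Submodule.sup_span_singleton_eq_of_finrank hXM' (by omega) hw fun h => hwM (hXM h)
  -- Otherwise `m` would be orthogonal to `X` and `w`, hence to `M'`, which is its own orthogonal.
  have hmw : QuadraticMap.polar q m w ≠ 0 := by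
    intro h0
    refine hm' ?_
    rw [← hq.polarPerp_eq hM' hMn', ← hMspan', polarPerp_sup]
    refine ⟨polarPerp_anti hXM (hM.le_polarPerp hm), mem_polarPerp.2 fun y hy => ?_⟩
    obtain ⟨c, rfl⟩ := Submodule.mem_span_singleton.1 hy
    rw [QuadraticMap.polar_smul_left, QuadraticMap.polar_comm, h0, smul_zero]
  obtain ⟨z, hz, hzM⟩ := aux hMn'' hMn hcon.1
  have hMspan'' :=
    Submodule.sup_span_singleton_eq_of_finrank hXM'' (by omega) hz fun h => hzM (hXM h)
  have hzX : z ∈ M ⊔ M' := by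
    -- Both have dimension `n + 1`. Modulo `X` this is a hyperbolic plane spanned by `m` and `w`,
    -- whose only singular lines are those two.
    have hsup : polarPerp q X = M ⊔ M' := by
      refine (Submodule.eq_of_le_of_finrank_le (sup_le (hM.le_polarPerp.trans (polarPerp_anti hXM))
        (hM'.le_polarPerp.trans (polarPerp_anti hXM'))) ?_).symm
      have : M < M ⊔ M' := left_lt_sup.2 fun h => hwM (h hw)
      have := Submodule.finrank_lt_finrank_of_lt this
      rw [hq.finrank_polarPerp]
      omega
    rw [← hsup]
    exact polarPerp_anti hXM'' (hM''.le_polarPerp hz)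
  rw [← hMspan, ← hMspan', sup_sup_sup_comm, sup_idem] at hzX
  obtain ⟨x, hx, y, hy, hxy⟩ := Submodule.mem_sup.1 hzX
  obtain ⟨y₁, hy₁, y₂, hy₂, rfl⟩ := Submodule.mem_sup.1 hy
  obtain ⟨α, rfl⟩ := Submodule.mem_span_singleton.1 hy₁
  obtain ⟨β, rfl⟩ := Submodule.mem_span_singleton.1 hy₂
  have hmem : α • m + β • w ∈ M'' := by
    have := M''.sub_mem hz (hXM'' hx)
    rwa [← hxy, add_sub_cancel_left] at this
  have h0 : α * (β * QuadraticMap.polar q m w) = 0 := by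
    have h1 := hM'' _ hmem
    have h2 : QuadraticMap.polar q (α • m) (β • w) = 0 := by
      rw [QuadraticMap.polar, h1, hM _ (M.smul_mem _ hm), hM' _ (M'.smul_mem _ hw)]
      simp
    rwa [QuadraticMap.polar_smul_left, QuadraticMap.polar_smul_right] at h2
  rcases mul_eq_zero.1 h0 with rfl | h0
  · refine hcon.2 (Submodule.eq_of_le_of_finrank_eq ?_ (by omega))
    rw [← hMspan'']
    refine sup_le hXM' ((Submodule.span_singleton_le_iff_mem _ _).2 ?_)
    rw [← hxy, zero_smul, zero_add]
    exact M'.add_mem (hXM' hx) (M'.smul_mem _ hw)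
  · rcases mul_eq_zero.1 h0 with rfl | h0
    · refine hzM ?_
      rw [← hxy, zero_smul, add_zero]
      exact M.add_mem (hXM hx) (M.smul_mem _ hm)
    · exact hmw h0

/-- Of two maximal totally singular subspaces that meet in dimension `n - 1`, exactly one is in the
family of a given one. -/
theorem HasCanonicalForm.sameFamily_iff_not (hq : HasCanonicalForm q E)
    {M M' N : Submodule K V} (hM : IsTotallySingular q M)
    (hMn : Module.finrank K M = n) (hM' : IsTotallySingular q M')
    (hMn' : Module.finrank K M' = n) (hN : IsTotallySingular q N)
    (hNn : Module.finrank K N = n)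
    (h : Module.finrank K (M ⊓ M' : Submodule K V) + 1 = n) :
    SameFamily M N ↔ ¬ SameFamily M' N := by
  have := Module.Finite.of_basis E
  have hne : M ≠ M' := by
    rintro rfl
    rw [inf_idem] at h
    omega
  have main : ∀ {M M' : Submodule K V}, Module.finrank K M = n → Module.finrank K M' = n →
      IsTotallySingular q M' → Module.finrank K (M ⊓ M' : Submodule K V) + 1 = n →
      (M ⊓ M') ⊔ (polarPerp q (M ⊓ M') ⊓ N) = M →
      (SameFamily M N ↔ ¬ SameFamily M' N) := by
    intro M M' hMn hMn' hM' h hT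
    have h1 : M' ⊓ N = (M ⊓ M') ⊓ N := by
      refine le_antisymm (fun x hx => ⟨⟨?_, hx.1⟩, hx.2⟩) (inf_le_inf_right _ inf_le_right)
      rw [← hT]
      exact le_sup_right (α := Submodule K V)
        ⟨polarPerp_anti inf_le_right (hM'.le_polarPerp hx.1), hx.2⟩
    have h2 : polarPerp q (M ⊓ M') ⊓ N ≤ M ⊓ N := by
      refine le_inf ?_ inf_le_right
      exact le_sup_right.trans hT.le
    have h3 := hq.finrank_polarPerp_inf (X := M ⊓ M') hN hNn
    have h4 := Submodule.finrank_mono h2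
    have h5 := Submodule.finrank_sup_add_finrank_inf_eq (M ⊓ N) (M ⊓ M')
    have h6 : (M ⊓ N) ⊓ (M ⊓ M') = M ⊓ M' ⊓ N := by
      rw [← inf_inf_distrib_left, inf_comm N, inf_assoc]
    have h7 := Submodule.finrank_mono (sup_le inf_le_left inf_le_left : (M ⊓ N) ⊔ (M ⊓ M') ≤ M)
    have h8 := Submodule.finrank_mono (inf_le_left : M ⊓ N ≤ M)
    rw [h6] at h5
    rw [SameFamily, SameFamily, h1, hMn, hMn', Nat.even_iff, Nat.even_iff]
    omega
  have hX := hM.mono (inf_le_left : M ⊓ M' ≤ M)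
  rcases hq.eq_or_eq_of_le h hM hMn inf_le_left hM' hMn' inf_le_right (hX.sup_polarPerp_inf hN)
    (hq.finrank_sup_polarPerp_inf hX hN hNn) le_sup_left hne with hT | hT
  · exact main hMn hMn' hM' h hT
  · rw [inf_comm] at h hT
    rw [main hMn' hMn hM h hT, not_not]

/-! ### Rationality and the quadratic form -/

variable {K₀ : Subfield K}

theorem HasCanonicalForm.polar_coordMap (hq : HasCanonicalForm q E) {f : K →+ K}
    (hf : IsRightLinear K₀ f) (x : V) {y : V} (hy : IsRationalVector E K₀ y) :
    QuadraticMap.polar q (coordMap E f x) y = f (QuadraticMap.polar q x y) := by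
  rw [hq.polar_eq, hq.polar_eq, map_sum]
  refine Finset.sum_congr rfl fun i _ => ?_
  rw [map_add, repr_coordMap, repr_coordMap, hf _ _ (hy _), hf _ _ (hy _)]

theorem HasCanonicalForm.polar_mem (hq : HasCanonicalForm q E) {x y : V}
    (hx : IsRationalVector E K₀ x) (hy : IsRationalVector E K₀ y) :
    QuadraticMap.polar q x y ∈ K₀ := by
  rw [hq.polar_eq]
  exact K₀.sum_mem fun i _ =>
    K₀.add_mem (K₀.mul_mem (hx _) (hy _)) (K₀.mul_mem (hx _) (hy _))

theorem HasCanonicalForm.apply_mem (hq : HasCanonicalForm q E) {x : V}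
    (hx : IsRationalVector E K₀ x) : q x ∈ K₀ := by
  rw [hq]
  exact K₀.sum_mem fun i _ => K₀.mul_mem (hx _) (hx _)

/-- By the stability criterion it suffices that `coordMap E f y` remain orthogonal to `X`. This can
be tested on rational vectors of `X`, where `f` commutes with the pairing. -/
theorem IsRationalSubspace.polarPerp (hq : HasCanonicalForm q E) {X : Submodule K V}
    (hX : IsRationalSubspace E K₀ X) : IsRationalSubspace E K₀ (polarPerp q X) := by
  refine isRationalSubspace_of_coordMap_mem fun f hf _ y hy => ?_
  have hle : X ≤ _root_.polarPerp q (Submodule.span K {coordMap E f y}) := by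
    refine hX.le_of_forall fun x hx hxr => mem_polarPerp.2 fun z hz => ?_
    obtain ⟨c, rfl⟩ := Submodule.mem_span_singleton.1 hz
    rw [QuadraticMap.polar_smul_left, hq.polar_coordMap hf _ hxr, QuadraticMap.polar_comm,
      mem_polarPerp.1 hy x hx, map_zero, smul_zero]
  refine mem_polarPerp.2 fun x hx => ?_
  rw [QuadraticMap.polar_comm]
  exact mem_polarPerp.1 (hle hx) _ (Submodule.mem_span_singleton_self _)

theorem HasCanonicalForm.exists_rational (hq : HasCanonicalForm q E) (K₀ : Subfield K) :
    ∃ N : Submodule K V, IsTotallySingular q N ∧ Module.finrank K N = n ∧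
      IsRationalSubspace E K₀ N := by
  have hli : LinearIndependent K fun i : Fin n => E (i, 0) :=
    E.linearIndependent.comp _ fun i j h => (Prod.ext_iff.1 h).1
  refine ⟨Submodule.span K (Set.range fun i : Fin n => E (i, 0)), fun x hx => ?_, ?_, ?_⟩
  · have h0 : ∀ i, E.repr x (i, 1) = 0 := by
      intro i
      induction hx using Submodule.span_induction with
      | mem x hx =>
        obtain ⟨j, rfl⟩ := hx
        simp
      | zero => simp
      | add x y _ _ hx hy => simp [hx, hy]
      | smul c x _ hx => simp [hx]
    simp [hq x, h0]
  · rw [finrank_span_eq_card hli, Fintype.card_fin]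
  · refine isRationalSubspace_span ?_
    rintro _ ⟨i, rfl⟩
    exact isRationalVector_basis _

/-- A maximal totally singular subspace that has a rational hyperplane is rational. -/
theorem HasCanonicalForm.isRationalSubspace_of_le (hq : HasCanonicalForm q E)
    {X M : Submodule K V} (hXr : IsRationalSubspace E K₀ X)
    (hM : IsTotallySingular q M) (hMn : Module.finrank K M = n) (hXM : X ≤ M)
    (hX : n ≤ Module.finrank K X + 1) : IsRationalSubspace E K₀ M := by
  have := Module.Finite.of_basis E
  rcases Nat.lt_or_ge (Module.finrank K X) n with hlt | hge
  swap
  · rwa [← Submodule.eq_of_le_of_finrank_le hXM (hMn.trans_le hge)]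
  have hXn : Module.finrank K X + 1 = n := by omega
  obtain ⟨N, hN, hNn, hNr⟩ := hq.exists_rational K₀
  have hXs := hM.mono hXM
  have hM' := hXs.sup_polarPerp_inf hN
  have hMn' := hq.finrank_sup_polarPerp_inf hXs hN hNn
  have hMr' := hXr.sup ((hXr.polarPerp hq).inf hNr)
  have hXM' : X ≤ X ⊔ (polarPerp q X ⊓ N) := le_sup_left
  generalize X ⊔ (polarPerp q X ⊓ N) = M' at hM' hMn' hMr' hXM'
  -- `M'` is one rational maximal subspace on `X`; a second comes from a singular rational vector of
  -- the orthogonal of `X` outside `M'`. A rational `u` outside `M'` exists by dimension, `n + 1`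
  -- against `n`, and is corrected below to a singular vector.
  obtain ⟨u, hu, hur, huM'⟩ : ∃ u ∈ polarPerp q X, IsRationalVector E K₀ u ∧ u ∉ M' := by
    by_contra! hcon
    have := Submodule.finrank_mono ((hXr.polarPerp hq).le_of_forall hcon)
    rw [hq.finrank_polarPerp] at this
    omega
  obtain ⟨w, hw, hwr, hwX⟩ : ∃ w ∈ M', IsRationalVector E K₀ w ∧ w ∉ X := by
    by_contra! hcon
    have := Submodule.finrank_mono (hMr'.le_of_forall hcon)
    omega
  have hM'span := Submodule.sup_span_singleton_eq_of_finrank hXM' (by omega) hw hwX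
  have huw : QuadraticMap.polar q u w ≠ 0 := by
    intro h0
    refine huM' ?_
    rw [← hq.polarPerp_eq hM' hMn', ← hM'span, polarPerp_sup]
    refine ⟨hu, mem_polarPerp.2 fun y hy => ?_⟩
    obtain ⟨c, rfl⟩ := Submodule.mem_span_singleton.1 hy
    rw [QuadraticMap.polar_smul_left, QuadraticMap.polar_comm, h0, smul_zero]
  -- Since `q w = 0`, the form is affine along `u + t • w`, and `t = -c` is its zero; it lies in
  -- `K₀` because `u` and `w` are rational.
  set c := q u / QuadraticMap.polar q u w with hc
  have hcK : c ∈ K₀ := K₀.div_mem (hq.apply_mem hur) (hq.polar_mem hur hwr)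
  have hq0 : q (u + (-c) • w) = 0 := by
    have h1 : QuadraticMap.polar q u ((-c) • w) = -c * QuadraticMap.polar q u w := by
      rw [QuadraticMap.polar_smul_right, smul_eq_mul]
    rw [QuadraticMap.polar, hM' _ (M'.smul_mem _ hw), sub_zero, sub_eq_iff_eq_add] at h1
    rw [h1, hc]
    field_simp
    ring
  have hzM' : u + (-c) • w ∉ M' := fun h => huM' ((M'.add_mem_iff_left (M'.smul_mem _ hw)).1 h)
  have hzr : IsRationalVector E K₀ (u + (-c) • w) := fun i => by
    simpa using K₀.add_mem (hur i) (K₀.mul_mem (K₀.neg_mem hcK) (hwr i))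
  have hzX : u + (-c) • w ∈ polarPerp q X :=
    (polarPerp q X).add_mem hu ((polarPerp q X).smul_mem _
      (polarPerp_anti hXM' (hM'.le_polarPerp hw)))
  generalize u + (-c) • w = z at hq0 hzM' hzr hzX
  have hs : IsTotallySingular q (X ⊔ Submodule.span K {z}) :=
    hXs.sup (isTotallySingular_span_singleton hq0)
      ((Submodule.span_singleton_le_iff_mem _ _).2 hzX)
  have hr : IsRationalSubspace E K₀ (X ⊔ Submodule.span K {z}) :=
    hXr.sup (isRationalSubspace_span (by rintro _ rfl; exact hzr))
  have hdim : Module.finrank K (X ⊔ Submodule.span K {z} : Submodule K V) = n := by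
    have hz0 : z ≠ 0 := by rintro rfl; exact hzM' M'.zero_mem
    have h1 := Submodule.finrank_sup_add_finrank_inf_eq X (Submodule.span K {z})
    rw [finrank_span_singleton hz0] at h1
    have h2 : X < X ⊔ Submodule.span K {z} := left_lt_sup.2 fun h =>
      hzM' (hXM' ((Submodule.span_singleton_le_iff_mem _ _).1 h))
    have := Submodule.finrank_lt_finrank_of_lt h2
    omega
  have hne : X ⊔ Submodule.span K {z} ≠ M' := fun h =>
    hzM' (h ▸ (le_sup_right (α := Submodule K V) (Submodule.mem_span_singleton_self z)))
  rcases hq.eq_or_eq_of_le hXn hs hdim le_sup_left hM' hMn' hXM' hM hMn hXM hne with h | h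
  · rwa [h]
  · rwa [h]

end TotallySingular

/-! ### Splitting nodes and lines of Grassmannians -/

namespace SubspaceGeometry

variable {K : Type*} {V : Type*} [DivisionRing K] [AddCommGroup V] [Module K V] {I : Type*}
  {Δ : SubspaceGeometry K V I} {J : Set I} {t : I}

/-- A node `t` splits `J` if some property of nodes that is constant along the edges off `t` is not
constant on `J`. -/
theorem splits_of_side (s : I → Prop)
    (hs : ∀ a b, Δ.diagram.Adj a b → a ≠ t → b ≠ t → (s a ↔ s b)) (ht : t ∉ J) {a b : I}
    (ha : a ∈ J) (hb : b ∈ J) (hsa : s a) (hsb : ¬ s b) : Δ.Splits t J := by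
  refine ⟨ht, ?_⟩
  rintro ⟨C, hC⟩
  obtain ⟨a', ha', rfl⟩ := hC ha
  obtain ⟨b', hb', rfl⟩ := hC hb
  obtain ⟨w⟩ := SimpleGraph.ConnectedComponent.exact (ha'.trans hb'.symm)
  clear ha' hb' ha hb
  induction w with
  | nil => exact hsb hsa
  | cons h _ ih => exact ih ((hs _ _ h (Subtype.prop (p := (· ∈ ({t}ᶜ : Set I))) _)
      (Subtype.prop (p := (· ∈ ({t}ᶜ : Set I))) _)).1 hsa) hsb

theorem not_splits_of_reachable {c : I} (hc : c ≠ t)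
    (h : ∀ a ∈ J, ∀ hat : a ≠ t, (Δ.diagram.induce {t}ᶜ).Reachable ⟨a, hat⟩ ⟨c, hc⟩) :
    ¬ Δ.Splits t J := by
  rintro ⟨ht, hsplit⟩
  refine hsplit ⟨(Δ.diagram.induce {t}ᶜ).connectedComponentMk ⟨c, hc⟩, fun a ha => ?_⟩
  have hat : a ≠ t := fun h => ht (h ▸ ha)
  exact ⟨⟨a, hat⟩, SimpleGraph.ConnectedComponent.sound (h a ha hat), rfl⟩

/-- The flag that is the line has an element of type `i` too, and incident elements of the same type
coincide. -/
theorem Gr.elem_eq {l : (Δ.Gr J).Line} {P R : Δ.Flag J} (hP : (Δ.Gr J).Inc P l)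
    (hR : (Δ.Gr J).Inc R l) (i : J) (hi : i ≠ l.1) : P.elem i = R.elem i := by
  have hi' : (i : I) ∈ (J \ {(l.1 : I)}) ∪ Δ.diagram.neighborSet (l.1 : I) :=
    Or.inl ⟨i.2, fun h => hi (Subtype.ext h)⟩
  have h1 := (Δ.inc_self (P.isElem i) (l.2.isElem ⟨i, hi'⟩)).1 (hP i ⟨i, hi'⟩)
  have h2 := (Δ.inc_self (R.isElem i) (l.2.isElem ⟨i, hi'⟩)).1 (hR i ⟨i, hi'⟩)
  rw [h1, h2]

theorem Gr.elem_ne {l : (Δ.Gr J).Line} {P R : Δ.Flag J} (hne : P ≠ R)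
    (hP : (Δ.Gr J).Inc P l) (hR : (Δ.Gr J).Inc R l) : P.elem l.1 ≠ R.elem l.1 := by
  intro h
  refine hne (Flag.ext (funext fun i => ?_))
  by_cases hi : i = l.1
  · rw [hi, h]
  · exact elem_eq hP hR i hi

/-- Every neighbour of the varying type of a line has an element that is incident with all elements
of the points on that line. -/
theorem Gr.exists_inc {l : (Δ.Gr J).Line} (ht : Δ.diagram.Adj l.1 t) :
    ∃ U, Δ.IsElem t U ∧
      ∀ P : Δ.Flag J, (Δ.Gr J).Inc P l → ∀ i : J, Δ.Inc i t (P.elem i) U :=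
  ⟨l.2.elem ⟨t, Or.inr ht⟩, l.2.isElem ⟨t, Or.inr ht⟩, fun _ hP i => hP i ⟨t, Or.inr ht⟩⟩

end SubspaceGeometry

/-! ### Comparable subspaces and dimension -/

section Dimension

variable {K : Type*} {V : Type*} [DivisionRing K] [AddCommGroup V] [Module K V]
  [FiniteDimensional K V] {X Y Z : Submodule K V}

theorem le_of_comparable_of_finrank_le (h : X ≤ Y ∨ Y ≤ X)
    (hd : Module.finrank K X ≤ Module.finrank K Y) : X ≤ Y :=
  h.elim id fun h => (Submodule.eq_of_le_of_finrank_le h hd).ge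

theorem eq_sup_of_finrank (hX : X ≤ Z) (hY : Y ≤ Z) (hne : X ≠ Y)
    (hXY : Module.finrank K X = Module.finrank K Y)
    (hd : Module.finrank K Z = Module.finrank K X + 1) : X ⊔ Y = Z := by
  refine Submodule.eq_of_le_of_finrank_le (sup_le hX hY) ?_
  rw [hd]
  exact Submodule.finrank_lt_finrank_of_lt (left_lt_sup.2 fun h =>
    hne (Submodule.eq_of_le_of_finrank_eq h hXY.symm).symm)

theorem eq_inf_of_finrank (hX : Z ≤ X) (hY : Z ≤ Y) (hne : X ≠ Y)
    (hXY : Module.finrank K X = Module.finrank K Y)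
    (hd : Module.finrank K X = Module.finrank K Z + 1) : X ⊓ Y = Z := by
  refine (Submodule.eq_of_le_of_finrank_le (le_inf hX hY) ?_).symm
  have := Submodule.finrank_lt_finrank_of_lt (inf_lt_left.2 fun h : X ≤ Y =>
    hne (Submodule.eq_of_le_of_finrank_eq h hXY))
  omega

end Dimension

/-! ### The Grassmannian of type `{1, n}` of `A_n` -/

section TypeA

variable {K : Type u} {V : Type*} [DivisionRing K] [AddCommGroup V] [Module K V] {n : ℕ}
  {E : Module.Basis (Fin (n + 1)) K V} {K₀ : Subfield K}

/-- An `X` of extreme dimension is an element of the flag; any other dimension is an interior node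
of the path and separates its ends. -/
theorem mem_omega_geometryA_iff (hn : 3 ≤ n) (E : Module.Basis (Fin (n + 1)) K V)
    (F : (geometryA K V n).Flag (typesA hn)) :
    F ∈ (geometryA K V n).Omega E K₀ (typesA hn) ↔ ∃ X, IsRationalSubspace E K₀ X ∧
      F.elem ⟨_, Or.inl rfl⟩ ≤ X ∧ X ≤ F.elem ⟨_, Or.inr rfl⟩ := by
  have := Module.Finite.of_basis E
  set p := F.elem ⟨_, Or.inl rfl⟩ with hp
  set H := F.elem ⟨_, Or.inr rfl⟩ with hH
  have hpd : Module.finrank K p = 0 + 1 := F.isElem _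
  have hHd : Module.finrank K H = n - 1 + 1 := F.isElem _
  have hpH : p ≤ H := le_of_comparable_of_finrank_le
    (F.inc ⟨_, Or.inl rfl⟩ ⟨_, Or.inr rfl⟩) (by omega)
  constructor
  · rintro (⟨⟨j, rfl | rfl⟩, hj⟩ | ⟨t, X, ht, hX, hXr, hinc⟩)
    · exact ⟨p, hj, le_rfl, hpH⟩
    · exact ⟨H, hj, hpH, le_rfl⟩
    · have hX : Module.finrank K X = t + 1 := hX
      have htn := t.2
      exact ⟨X, hXr, le_of_comparable_of_finrank_le (hinc ⟨_, Or.inl rfl⟩).symm (by omega),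
        le_of_comparable_of_finrank_le (hinc ⟨_, Or.inr rfl⟩) (by omega)⟩
  · rintro ⟨X, hXr, hpX, hXH⟩
    have h1 := Submodule.finrank_mono hpX
    have h2 := Submodule.finrank_mono hXH
    rcases h1.eq_or_lt with h1 | h1
    · rw [← Submodule.eq_of_le_of_finrank_eq hpX h1] at hXr
      exact Or.inl ⟨_, hXr⟩
    rcases h2.eq_or_lt with h2 | h2
    · rw [Submodule.eq_of_le_of_finrank_eq hXH h2] at hXr
      exact Or.inl ⟨_, hXr⟩
    refine Or.inr ⟨⟨Module.finrank K X - 1, by omega⟩, X, ?_, ?_, hXr, ?_⟩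
    · refine SubspaceGeometry.splits_of_side (fun i => (i : ℕ) < Module.finrank K X - 1) ?_ ?_
        (Or.inl rfl) (Or.inr rfl) ?_ ?_
      · intro a b hab ha hb
        have hab := SimpleGraph.pathGraph_adj.1 hab
        simp only [ne_eq, Fin.ext_iff] at ha hb
        omega
      · rintro (h | h) <;> have h := congrArg Fin.val h <;> dsimp only at h <;> omega
      · show 0 < _
        omega
      · show ¬ n - 1 < _
        omega
    · show Module.finrank K X = Module.finrank K X - 1 + 1
      omega
    · rintro ⟨j, rfl | rfl⟩
      · exact Or.inr hpX
      · exact Or.inl hXH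

/-- The sum of the two intermediate rational subspaces works when the 1-space varies, their
intersection when the hyperplane varies. -/
theorem isSubspace_omega_geometryA (hn : 3 ≤ n) (E : Module.Basis (Fin (n + 1)) K V) :
    ((geometryA K V n).Gr (typesA hn)).IsSubspace
      ((geometryA K V n).Omega E K₀ (typesA hn)) := by
  have := Module.Finite.of_basis E
  intro l (P : (geometryA K V n).Flag (typesA hn)) (P' : (geometryA K V n).Flag (typesA hn))
    hne hP hP' hPl hPl' (R : (geometryA K V n).Flag (typesA hn)) hRl
  obtain ⟨X, hX, hpX, hXH⟩ := (mem_omega_geometryA_iff hn E P).1 hP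
  obtain ⟨X', hX', hpX', hXH'⟩ := (mem_omega_geometryA_iff hn E P').1 hP'
  refine (mem_omega_geometryA_iff hn E R).2 ?_
  have hpd : ∀ F : (geometryA K V n).Flag (typesA hn),
    Module.finrank K (F.elem ⟨_, Or.inl rfl⟩) = 0 + 1 := fun F => F.isElem _
  have hHd : ∀ F : (geometryA K V n).Flag (typesA hn),
    Module.finrank K (F.elem ⟨_, Or.inr rfl⟩) = n - 1 + 1 := fun F => F.isElem _
  have h0 : (⟨⟨0, by omega⟩, Or.inl rfl⟩ : typesA hn) ≠ ⟨⟨n - 1, by omega⟩, Or.inr rfl⟩ := by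
    intro h
    have h := congrArg (fun i : typesA hn => ((i : Fin n) : ℕ)) h
    dsimp only at h
    omega
  have helem := SubspaceGeometry.Gr.elem_ne hne hPl hPl'
  obtain ⟨⟨j, rfl | rfl⟩, L⟩ := l
  · obtain ⟨U, hU, hinc⟩ := SubspaceGeometry.Gr.exists_inc (Δ := geometryA K V n)
      (J := typesA hn) (l := ⟨⟨_, Or.inl rfl⟩, L⟩) (t := ⟨1, by omega⟩)
      (SimpleGraph.pathGraph_adj.2 (Or.inl rfl))
    have hU : Module.finrank K U = 1 + 1 := hU
    have hle : ∀ F : (geometryA K V n).Flag (typesA hn), F.Incident L →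
        F.elem ⟨_, Or.inl rfl⟩ ≤ U := fun F hF =>
      le_of_comparable_of_finrank_le (hinc F hF _) (by rw [hU, hpd]; omega)
    have hsup := eq_sup_of_finrank (hle P hPl) (hle P' hPl') helem (by rw [hpd, hpd])
      (by rw [hU, hpd])
    refine ⟨X ⊔ X', hX.sup hX', ?_, ?_⟩
    · exact (hle R hRl).trans (hsup ▸ sup_le_sup hpX hpX')
    · refine sup_le ?_ ?_
      · rwa [← SubspaceGeometry.Gr.elem_eq hPl hRl _ h0.symm]
      · rwa [← SubspaceGeometry.Gr.elem_eq hPl' hRl _ h0.symm]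
  · obtain ⟨U, hU, hinc⟩ := SubspaceGeometry.Gr.exists_inc (Δ := geometryA K V n)
      (J := typesA hn) (l := ⟨⟨_, Or.inr rfl⟩, L⟩) (t := ⟨n - 2, by omega⟩)
      (SimpleGraph.pathGraph_adj.2 (Or.inr (show n - 2 + 1 = n - 1 by omega)))
    have hU : Module.finrank K U = n - 2 + 1 := hU
    have hle : ∀ F : (geometryA K V n).Flag (typesA hn), F.Incident L →
        U ≤ F.elem ⟨_, Or.inr rfl⟩ := fun F hF =>
      le_of_comparable_of_finrank_le (hinc F hF _).symm (by rw [hU, hHd]; omega)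
    have hinf := eq_inf_of_finrank (hle P hPl) (hle P' hPl') helem (by rw [hHd, hHd])
      (by rw [hU, hHd]; omega)
    refine ⟨X ⊓ X', hX.inf hX', ?_, ?_⟩
    · refine le_inf ?_ ?_
      · rwa [← SubspaceGeometry.Gr.elem_eq hPl hRl _ h0]
      · rwa [← SubspaceGeometry.Gr.elem_eq hPl' hRl _ h0]
    · exact (inf_le_inf hXH hXH').trans (hinf ▸ hle R hRl)

theorem omega_geometryA_ne_univ (hK₀ : K₀ ≠ ⊤) (hn : 3 ≤ n)
    (E : Module.Basis (Fin (n + 1)) K V) :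
    (geometryA K V n).Omega E K₀ (typesA hn) ≠ Set.univ := by
  have := Module.Finite.of_basis E
  obtain ⟨a, -, ha⟩ := SetLike.exists_of_lt (lt_top_iff_ne_top.2 hK₀)
  let i₀ : Fin (n + 1) := ⟨0, by omega⟩
  let i₁ : Fin (n + 1) := ⟨1, by omega⟩
  have hi : i₀ ≠ i₁ := by simp [i₀, i₁]
  let y : V := E i₀ + a • E i₁
  have hy0 : E.repr y i₀ = 1 := by simp [y, hi]
  have hy1 : E.repr y i₁ = a := by simp [y, hi.symm]
  -- The factor `a` stands on the right, to keep `φ` linear over a division ring. A rational vector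
  -- of the kernel with nonzero `i₀`-coordinate would exhibit `a` as a quotient of elements of `K₀`.
  let φ : V →ₗ[K] K := E.coord i₁ - (LinearMap.toSpanSingleton K K a).comp (E.coord i₀)
  have hφ : ∀ x, φ x = E.repr x i₁ - E.repr x i₀ * a := fun x => rfl
  let p := Submodule.span K {y}
  let H := LinearMap.ker φ
  have hyH : y ∈ H := by rw [LinearMap.mem_ker, hφ, hy0, hy1, one_mul, sub_self]
  have hpH : p ≤ H := (Submodule.span_singleton_le_iff_mem _ _).2 hyH
  have hpd : Module.finrank K p = 1 :=
    finrank_span_singleton (by intro h; simp [h] at hy0)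
  have hHd : Module.finrank K H = n := by
    have h1 := LinearMap.finrank_range_add_finrank_ker φ
    have h2 : LinearMap.range φ = ⊤ := LinearMap.range_eq_top.2 fun c => by
      refine ⟨c • E i₁, ?_⟩
      rw [hφ]
      simp [hi]
    rw [h2, finrank_top, Module.finrank_self, Module.finrank_eq_card_basis E,
      Fintype.card_fin] at h1
    change Module.finrank K (LinearMap.ker φ) = n
    omega
  let F : (geometryA K V n).Flag (typesA hn) :=
    { elem := fun j => if (j : Fin n) = ⟨0, by omega⟩ then p else H
      isElem := by
        rintro ⟨j, rfl | rfl⟩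
        · rw [if_pos rfl]
          exact hpd
        · rw [if_neg (by simp only [Fin.mk.injEq]; omega)]
          show Module.finrank K H = n - 1 + 1
          omega
      inc := fun i j => by
        show (_ ≤ _) ∨ (_ ≤ _)
        split_ifs
        · exact Or.inl le_rfl
        · exact Or.inl hpH
        · exact Or.inr hpH
        · exact Or.inl le_rfl }
  intro huniv
  obtain ⟨X, hX, hpX, hXH⟩ := (mem_omega_geometryA_iff hn E F).1 (huniv ▸ Set.mem_univ F)
  have hpX : p ≤ X := hpX
  have hXH : X ≤ H := by
    refine hXH.trans (le_of_eq (if_neg ?_))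
    simp only [Fin.mk.injEq]
    omega
  have hle : X ≤ LinearMap.ker (E.coord i₀) := by
    refine hX.le_of_forall fun x hx hxr => ?_
    rw [LinearMap.mem_ker, E.coord_apply]
    by_contra h0
    have h1 := hXH hx
    rw [LinearMap.mem_ker, hφ, sub_eq_zero] at h1
    refine ha ?_
    rw [← inv_mul_cancel_left₀ h0 a, ← h1]
    exact K₀.mul_mem (K₀.inv_mem (hxr _)) (hxr _)
  have := hle (hpX (Submodule.mem_span_singleton_self y))
  rw [LinearMap.mem_ker, E.coord_apply, hy0] at this
  exact one_ne_zero this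

end TypeA

/-! ### The Grassmannians of `D_n` -/

section TypeD

variable {K : Type u} {V : Type*} [Field K] [AddCommGroup V] [Module K V] {n : ℕ}

variable {hn : 3 ≤ n} {q : QuadraticForm K V} {E : Module.Basis (Fin n × Fin 2) K V}
  {M₀ : Submodule K V} {J : Set (DNode n)} {K₀ : Subfield K}

theorem comparable_of_inc_left {i : Fin (n - 2)} {t : DNode n} {X Y : Submodule K V}
    (h : (geometryD hn q M₀).Inc (.low i) t X Y) : X ≤ Y ∨ Y ≤ X := by
  cases t <;> exact h

theorem comparable_of_inc_right {i : Fin (n - 2)} {t : DNode n} {X Y : Submodule K V}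
    (h : (geometryD hn q M₀).Inc t (.low i) X Y) : X ≤ Y ∨ Y ≤ X := by
  cases t <;> exact h

theorem IsElemD.isTotallySingular {t : DNode n} {X : Submodule K V} (h : IsElemD q n M₀ t X) :
    IsTotallySingular q X := by
  cases t <;> exact h.1

theorem geometryD_flag_isTotallySingular (F : (geometryD hn q M₀).Flag J) (j : J) :
    IsTotallySingular q (F.elem j) :=
  IsElemD.isTotallySingular (F.isElem j)

theorem geometryD_flag_finrank_one (F : (geometryD hn q M₀).Flag J) (h : DNode.one hn ∈ J) :
    Module.finrank K (F.elem ⟨_, h⟩) = 1 :=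
  (F.isElem ⟨_, h⟩).2

theorem geometryD_flag_finrank (F : (geometryD hn q M₀).Flag J) {j : J}
    (hj : (j : DNode n) = .plus ∨ (j : DNode n) = .minus) : Module.finrank K (F.elem j) = n := by
  obtain ⟨j, hJ⟩ := j
  rcases hj with rfl | rfl
  · exact (F.isElem ⟨_, hJ⟩).2.1
  · exact (F.isElem ⟨_, hJ⟩).2.1

theorem geometryD_flag_finrank_inf (F : (geometryD hn q M₀).Flag J) (h : DNode.plus ∈ J)
    (h' : DNode.minus ∈ J) :
    Module.finrank K (F.elem ⟨_, h⟩ ⊓ F.elem ⟨_, h'⟩ : Submodule K V) = n - 1 :=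
  F.inc ⟨_, h⟩ ⟨_, h'⟩

theorem geometryD_flag_one_le [FiniteDimensional K V] (F : (geometryD hn q M₀).Flag J)
    (h : DNode.one hn ∈ J) {j : J} (hj : (j : DNode n) = .plus ∨ (j : DNode n) = .minus) :
    F.elem ⟨_, h⟩ ≤ F.elem j :=
  le_of_comparable_of_finrank_le (comparable_of_inc_left (hn := hn) (F.inc ⟨_, h⟩ j))
    (by rw [geometryD_flag_finrank_one, geometryD_flag_finrank F hj]; omega)

/-- The points on a line that varies the element of type `1` have that element in a common
subspace of dimension `2`. -/
theorem geometryD_exists_one_le [FiniteDimensional K V] {h : DNode.one hn ∈ J}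
    (L : (geometryD hn q M₀).Flag ((J \ {DNode.one hn}) ∪ (diagramD n).neighborSet (.one hn))) :
    ∃ U : Submodule K V, Module.finrank K U = 2 ∧
      ∀ F : (geometryD hn q M₀).Flag J, F.Incident L → F.elem ⟨_, h⟩ ≤ U := by
  -- For `n = 3` the neighbours of node 1 are `+` and `-`, and the plane is the intersection of two
  -- maximal subspaces; for larger `n` it is the element of type 2.
  rcases Nat.eq_or_lt_of_le hn with h3 | h4
  · have hp : DNode.plus ∈ (J \ {DNode.one hn}) ∪ (diagramD n).neighborSet (.one hn) :=
      Or.inr (show 0 + 1 = n - 2 by omega)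
    have hm : DNode.minus ∈ (J \ {DNode.one hn}) ∪ (diagramD n).neighborSet (.one hn) :=
      Or.inr (show 0 + 1 = n - 2 by omega)
    refine ⟨L.elem ⟨_, hp⟩ ⊓ L.elem ⟨_, hm⟩, ?_, fun F hF => le_inf ?_ ?_⟩
    · rw [geometryD_flag_finrank_inf]
      omega
    · exact le_of_comparable_of_finrank_le (comparable_of_inc_left (hn := hn) (hF ⟨_, h⟩ ⟨_, hp⟩))
        (by rw [geometryD_flag_finrank_one, geometryD_flag_finrank L (Or.inl rfl)]; omega)
    · exact le_of_comparable_of_finrank_le (comparable_of_inc_left (hn := hn) (hF ⟨_, h⟩ ⟨_, hm⟩))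
        (by rw [geometryD_flag_finrank_one, geometryD_flag_finrank L (Or.inr rfl)]; omega)
  · have h2 : DNode.low ⟨1, by omega⟩ ∈
        (J \ {DNode.one hn}) ∪ (diagramD n).neighborSet (.one hn) :=
      Or.inr (Or.inl (show 0 + 1 = 1 by omega))
    have hd : Module.finrank K (L.elem ⟨_, h2⟩) = 2 := (L.isElem ⟨_, h2⟩).2
    exact ⟨L.elem ⟨_, h2⟩, hd, fun F hF => le_of_comparable_of_finrank_le
      (comparable_of_inc_left (hn := hn) (hF ⟨_, h⟩ ⟨_, h2⟩)) (by rw [geometryD_flag_finrank_one, hd]; omega)⟩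

theorem geometryD_one_le_sup [FiniteDimensional K V] {l : ((geometryD hn q M₀).Gr J).Line}
    (h : DNode.one hn ∈ J) (hl : l.1 = ⟨_, h⟩) {P P' R : (geometryD hn q M₀).Flag J} (hne : P ≠ P')
    (hP : ((geometryD hn q M₀).Gr J).Inc P l) (hP' : ((geometryD hn q M₀).Gr J).Inc P' l)
    (hR : ((geometryD hn q M₀).Gr J).Inc R l) :
    R.elem ⟨_, h⟩ ≤ P.elem ⟨_, h⟩ ⊔ P'.elem ⟨_, h⟩ := by
  have helem := SubspaceGeometry.Gr.elem_ne hne hP hP'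
  obtain ⟨j, L⟩ := l
  obtain rfl : j = _ := hl
  obtain ⟨U, hU, hle⟩ := geometryD_exists_one_le (h := h) L
  rw [eq_sup_of_finrank (hle P hP) (hle P' hP') helem
    (by rw [geometryD_flag_finrank_one, geometryD_flag_finrank_one])
    (by rw [geometryD_flag_finrank_one, hU])]
  exact hle R hR

/-- Meeting in dimension `n - 1` would put the two subspaces in opposite families. -/
theorem HasCanonicalForm.finrank_inf_of_isElemD (hq : HasCanonicalForm q E)
    (hM₀ : IsTotallySingular q M₀) (hM₀n : Module.finrank K M₀ = n) {t : DNode n}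
    (ht : t = .plus ∨ t = .minus) {M M' : Submodule K V} (hM : IsElemD q n M₀ t M)
    (hM' : IsElemD q n M₀ t M') :
    Module.finrank K (M ⊓ M' : Submodule K V) + 1 ≠ n := by
  intro h
  rcases ht with rfl | rfl
  · have := hq.sameFamily_iff_not hM.1 hM.2.1 hM'.1 hM'.2.1 hM₀ hM₀n h
    exact this.1 hM.2.2 hM'.2.2
  · have := hq.sameFamily_iff_not hM.1 hM.2.1 hM'.1 hM'.2.1 hM₀ hM₀n h
    exact hM.2.2 (this.2 hM'.2.2)

/-- Two points on a line that varies the element of type `+` or `-` have as the intersection of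
these elements a subspace of dimension `n - 2`, which is common to all points of the line. -/
theorem HasCanonicalForm.line_inf (hq : HasCanonicalForm q E)
    (hM₀ : IsTotallySingular q M₀) (hM₀n : Module.finrank K M₀ = n)
    {l : ((geometryD hn q M₀).Gr J).Line}
    (hl : (l.1 : DNode n) = .plus ∨ (l.1 : DNode n) = .minus)
    {P P' : (geometryD hn q M₀).Flag J} (hne : P ≠ P')
    (hP : ((geometryD hn q M₀).Gr J).Inc P l) (hP' : ((geometryD hn q M₀).Gr J).Inc P' l) :
    Module.finrank K (P.elem l.1 ⊓ P'.elem l.1 : Submodule K V) + 2 = n ∧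
      ∀ R : (geometryD hn q M₀).Flag J, ((geometryD hn q M₀).Gr J).Inc R l →
        (∀ j : J, (j : DNode n) = .plus ∨ (j : DNode n) = .minus →
          P.elem l.1 ⊓ P'.elem l.1 ≤ R.elem j) ∧
        ∀ h : DNode.one hn ∈ J, R.elem ⟨_, h⟩ ≤ P.elem l.1 ⊓ P'.elem l.1 := by
  have := Module.Finite.of_basis E
  have helem := SubspaceGeometry.Gr.elem_ne hne hP hP'
  have hadj : (geometryD hn q M₀).diagram.Adj l.1 (.low ⟨n - 3, by omega⟩) := by
    rcases hl with hl | hl <;> rw [hl] <;> exact (show n - 3 + 1 = n - 2 by omega)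
  obtain ⟨U, hU, hinc⟩ := SubspaceGeometry.Gr.exists_inc hadj
  have hU : Module.finrank K U = n - 3 + 1 := hU.2
  have hle : ∀ R : (geometryD hn q M₀).Flag J, ((geometryD hn q M₀).Gr J).Inc R l →
      ∀ j : J, (j : DNode n) = .plus ∨ (j : DNode n) = .minus → U ≤ R.elem j :=
    fun R hR j hj => le_of_comparable_of_finrank_le (comparable_of_inc_right (hn := hn) (hinc R hR j)).symm
      (by rw [geometryD_flag_finrank R hj]; omega)
  -- The intersection contains `U`, of dimension `n - 2`, and is proper; dimension `n - 1` is
  -- excluded by the families.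
  have hinf : P.elem l.1 ⊓ P'.elem l.1 = U := by
    refine (Submodule.eq_of_le_of_finrank_le (le_inf (hle P hP _ hl) (hle P' hP' _ hl)) ?_).symm
    have h1 := hq.finrank_inf_of_isElemD hM₀ hM₀n hl (P.isElem l.1) (P'.isElem l.1)
    have h2 := Submodule.finrank_lt_finrank_of_lt (inf_lt_left.2 fun h =>
      helem (Submodule.eq_of_le_of_finrank_eq h
        (by rw [geometryD_flag_finrank P hl, geometryD_flag_finrank P' hl])))
    rw [geometryD_flag_finrank P hl] at h2
    omega
  rw [hinf]
  refine ⟨by omega, fun R hR => ⟨hle R hR, fun h => ?_⟩⟩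
  exact le_of_comparable_of_finrank_le (comparable_of_inc_right (hn := hn) (hinc R hR ⟨_, h⟩))
    (by rw [geometryD_flag_finrank_one]; omega)

theorem splits_geometryD_low {i : Fin (n - 2)} (hi : 0 < (i : ℕ)) (hiJ : DNode.low i ∉ J)
    (h : DNode.one hn ∈ J) {t : DNode n} (htJ : t ∈ J) (ht : t = .plus ∨ t = .minus) :
    (geometryD hn q M₀).Splits (.low i) J := by
  -- The nodes before `i` on the path form one side; positivity of `i` puts node 1 among them.
  let s : DNode n → Prop
    | .low j => j < i
    | _ => False
  refine SubspaceGeometry.splits_of_side s ?_ hiJ h htJ hi (by rcases ht with rfl | rfl <;> exact id)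
  have hi2 := i.2
  rintro (a | _ | _) (b | _ | _) hab ha hb <;>
    simp only [geometryD, diagramD, DNode.Adj, ne_eq, DNode.low.injEq, Fin.ext_iff] at hab ha hb <;>
    simp only [s, Fin.lt_def, iff_false, false_iff] <;> omega

/-- Removing the leaf `+` leaves a path from 1 to `-`, so rational elements of type `+` play no role
for `{1,-}`. -/
theorem not_splits_geometryD_plus :
    ¬ (geometryD hn q M₀).Splits .plus {DNode.one hn, DNode.minus} := by
  have key : ∀ k (hk : k < n - 2), ((geometryD hn q M₀).diagram.induce {DNode.plus}ᶜ).Reachable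
      ⟨.low ⟨k, hk⟩, nofun⟩ ⟨DNode.one hn, nofun⟩ := by
    intro k
    induction k with
    | zero => exact fun _ => .rfl
    | succ k ih =>
      intro hk
      refine SimpleGraph.Reachable.trans (SimpleGraph.Adj.reachable ?_) (ih (by omega))
      exact Or.inr rfl
  refine SubspaceGeometry.not_splits_of_reachable (c := .one hn) nofun ?_
  rintro a (rfl | rfl) hat
  · exact .rfl
  · refine SimpleGraph.Reachable.trans (SimpleGraph.Adj.reachable ?_) (key (n - 3) (by omega))
    exact (show n - 3 + 1 = n - 2 by omega)

/-- Both leaves hang on the node `n - 2`, whose index is `n - 3`; removing any other `low` node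
leaves them joined through it. -/
theorem splits_geometryD_plus_minus_iff (i : Fin (n - 2)) :
    (geometryD hn q M₀).Splits (.low i) {DNode.plus, DNode.minus} ↔ (i : ℕ) + 3 = n := by
  constructor
  · intro h
    by_contra hi
    have h1 : (DNode.low ⟨n - 3, by omega⟩ : DNode n) ≠ .low i := by
      simp only [ne_eq, DNode.low.injEq, Fin.ext_iff]
      omega
    refine SubspaceGeometry.not_splits_of_reachable h1 ?_ h
    rintro a (rfl | rfl) hat
    · exact SimpleGraph.Adj.reachable (show n - 3 + 1 = n - 2 by omega)
    · exact SimpleGraph.Adj.reachable (show n - 3 + 1 = n - 2 by omega)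
  · intro hi
    refine SubspaceGeometry.splits_of_side (· = .plus) ?_ (by simp) (a := .plus) (b := .minus)
      (Or.inl rfl) (Or.inr rfl) rfl nofun
    rintro (a | _ | _) (b | _ | _) hab ha hb <;>
      simp only [geometryD, diagramD, DNode.Adj, ne_eq, DNode.low.injEq, Fin.ext_iff] at hab ha hb <;>
      simp <;> omega

/-- Dimensions strictly between 1 and `n - 1` are splitting types. The dimension `n - 1`, which is
no type, is absorbed because it makes the maximal element rational. -/
theorem HasCanonicalForm.mem_omega_one_minus_iff (hq : HasCanonicalForm q E)
    (F : (geometryD hn q M₀).Flag {DNode.one hn, DNode.minus}) :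
    F ∈ (geometryD hn q M₀).Omega E K₀ {DNode.one hn, DNode.minus} ↔
      ∃ X, IsRationalSubspace E K₀ X ∧
        F.elem ⟨_, Or.inl rfl⟩ ≤ X ∧ X ≤ F.elem ⟨_, Or.inr rfl⟩ := by
  have := Module.Finite.of_basis E
  have hpd := geometryD_flag_finrank_one F (Or.inl rfl)
  have hMd := geometryD_flag_finrank F (j := ⟨_, Or.inr rfl⟩) (Or.inr rfl)
  have hpM := geometryD_flag_one_le F (Or.inl rfl) (j := ⟨_, Or.inr rfl⟩) (Or.inr rfl)
  constructor
  · rintro (⟨⟨j, rfl | rfl⟩, hj⟩ | ⟨t, X, ht, hX, hXr, hinc⟩)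
    · exact ⟨_, hj, le_rfl, hpM⟩
    · exact ⟨_, hj, hpM, le_rfl⟩
    · rcases t with i | _ | _
      · have hX : Module.finrank K X = i + 1 := hX.2
        have hi := i.2
        exact ⟨X, hXr,
          le_of_comparable_of_finrank_le (comparable_of_inc_left (hn := hn) (hinc ⟨_, Or.inl rfl⟩)).symm (by omega),
          le_of_comparable_of_finrank_le (comparable_of_inc_left (hn := hn) (hinc ⟨_, Or.inr rfl⟩)) (by omega)⟩
      · exact absurd ht not_splits_geometryD_plus
      · exact absurd (Or.inr rfl) ht.1
  · rintro ⟨X, hXr, hpX, hXM⟩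
    have hMs := geometryD_flag_isTotallySingular F ⟨_, Or.inr rfl⟩
    have h1 := Submodule.finrank_mono hpX
    rcases h1.eq_or_lt with h1 | h1
    · rw [← Submodule.eq_of_le_of_finrank_eq hpX h1] at hXr
      exact Or.inl ⟨_, hXr⟩
    rcases Nat.lt_or_ge (Module.finrank K X + 1) n with h2 | h2
    swap
    · exact Or.inl ⟨_, hq.isRationalSubspace_of_le hXr hMs hMd hXM h2⟩
    refine Or.inr ⟨.low ⟨Module.finrank K X - 1, by omega⟩, X, ?_, ⟨hMs.mono hXM, ?_⟩, hXr, ?_⟩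
    · refine splits_geometryD_low (show 0 < Module.finrank K X - 1 by omega) ?_ (Or.inl rfl)
        (Or.inr rfl) (Or.inr rfl)
      simp only [DNode.one, Set.mem_insert_iff, DNode.low.injEq, Fin.ext_iff,
        Set.mem_singleton_iff, reduceCtorEq, or_false]
      omega
    · show Module.finrank K X = Module.finrank K X - 1 + 1
      omega
    · rintro ⟨j, rfl | rfl⟩
      · exact Or.inr hpX
      · exact Or.inl hXM

theorem HasCanonicalForm.mem_omega_one_plus_minus_iff (hq : HasCanonicalForm q E)
    (F : (geometryD hn q M₀).Flag {DNode.one hn, DNode.plus, DNode.minus}) :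
    F ∈ (geometryD hn q M₀).Omega E K₀ {DNode.one hn, DNode.plus, DNode.minus} ↔
      IsRationalSubspace E K₀ (F.elem ⟨.plus, Or.inr (Or.inl rfl)⟩) ∨
      IsRationalSubspace E K₀ (F.elem ⟨.minus, Or.inr (Or.inr rfl)⟩) ∨
      ∃ X, IsRationalSubspace E K₀ X ∧ F.elem ⟨_, Or.inl rfl⟩ ≤ X ∧
        X ≤ F.elem ⟨.plus, Or.inr (Or.inl rfl)⟩ ∧ X ≤ F.elem ⟨.minus, Or.inr (Or.inr rfl)⟩ := by
  have := Module.Finite.of_basis E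
  have hpd := geometryD_flag_finrank_one F (Or.inl rfl)
  have hMd := geometryD_flag_finrank F (j := ⟨.plus, Or.inr (Or.inl rfl)⟩) (Or.inl rfl)
  have hMd' := geometryD_flag_finrank F (j := ⟨.minus, Or.inr (Or.inr rfl)⟩) (Or.inr rfl)
  have hpM := geometryD_flag_one_le F (Or.inl rfl) (j := ⟨.plus, Or.inr (Or.inl rfl)⟩) (Or.inl rfl)
  have hpM' :=
    geometryD_flag_one_le F (Or.inl rfl) (j := ⟨.minus, Or.inr (Or.inr rfl)⟩) (Or.inr rfl)
  constructor
  · rintro (⟨⟨j, rfl | rfl | rfl⟩, hj⟩ | ⟨t, X, ht, hX, hXr, hinc⟩)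
    · exact Or.inr (Or.inr ⟨_, hj, le_rfl, hpM, hpM'⟩)
    · exact Or.inl hj
    · exact Or.inr (Or.inl hj)
    · rcases t with i | _ | _
      · have hX : Module.finrank K X = i + 1 := hX.2
        have hi := i.2
        exact Or.inr (Or.inr ⟨X, hXr,
          le_of_comparable_of_finrank_le (comparable_of_inc_left (hn := hn) (hinc ⟨_, Or.inl rfl⟩)).symm (by omega),
          le_of_comparable_of_finrank_le
            (comparable_of_inc_left (hn := hn) (hinc ⟨_, Or.inr (Or.inl rfl)⟩)) (by omega),
          le_of_comparable_of_finrank_le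
            (comparable_of_inc_left (hn := hn) (hinc ⟨_, Or.inr (Or.inr rfl)⟩)) (by omega)⟩)
      · exact absurd (Or.inr (Or.inl rfl)) ht.1
      · exact absurd (Or.inr (Or.inr rfl)) ht.1
  · rintro (h | h | ⟨X, hXr, hpX, hXM, hXM'⟩)
    · exact Or.inl ⟨_, h⟩
    · exact Or.inl ⟨_, h⟩
    have hMs := geometryD_flag_isTotallySingular F ⟨.plus, Or.inr (Or.inl rfl)⟩
    have h1 := Submodule.finrank_mono hpX
    rcases h1.eq_or_lt with h1 | h1
    · rw [← Submodule.eq_of_le_of_finrank_eq hpX h1] at hXr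
      exact Or.inl ⟨_, hXr⟩
    rcases Nat.lt_or_ge (Module.finrank K X + 1) n with h2 | h2
    swap
    · exact Or.inl ⟨_, hq.isRationalSubspace_of_le hXr hMs hMd hXM h2⟩
    refine Or.inr ⟨.low ⟨Module.finrank K X - 1, by omega⟩, X, ?_, ⟨hMs.mono hXM, ?_⟩, hXr, ?_⟩
    · refine splits_geometryD_low (show 0 < Module.finrank K X - 1 by omega) ?_ (Or.inl rfl)
        (Or.inr (Or.inl rfl)) (Or.inl rfl)
      simp only [DNode.one, Set.mem_insert_iff, DNode.low.injEq, Fin.ext_iff,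
        Set.mem_singleton_iff, reduceCtorEq, or_false]
      omega
    · show Module.finrank K X = Module.finrank K X - 1 + 1
      omega
    · rintro ⟨j, rfl | rfl | rfl⟩
      · exact Or.inr hpX
      · exact Or.inl hXM
      · exact Or.inl hXM'

theorem mem_omega_plus_minus_iff (E : Module.Basis (Fin n × Fin 2) K V)
    (F : (geometryD hn q M₀).Flag {DNode.plus, DNode.minus}) :
    F ∈ (geometryD hn q M₀).Omega E K₀ {DNode.plus, DNode.minus} ↔
      IsRationalSubspace E K₀ (F.elem ⟨.plus, Or.inl rfl⟩) ∨
      IsRationalSubspace E K₀ (F.elem ⟨.minus, Or.inr rfl⟩) ∨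
      ∃ X, IsRationalSubspace E K₀ X ∧ Module.finrank K X + 2 = n ∧
        X ≤ F.elem ⟨.plus, Or.inl rfl⟩ ∧ X ≤ F.elem ⟨.minus, Or.inr rfl⟩ := by
  have := Module.Finite.of_basis E
  have hMd := geometryD_flag_finrank F (j := ⟨.plus, Or.inl rfl⟩) (Or.inl rfl)
  have hMd' := geometryD_flag_finrank F (j := ⟨.minus, Or.inr rfl⟩) (Or.inr rfl)
  constructor
  · rintro (⟨⟨j, rfl | rfl⟩, hj⟩ | ⟨t, X, ht, hX, hXr, hinc⟩)
    · exact Or.inl hj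
    · exact Or.inr (Or.inl hj)
    · rcases t with i | _ | _
      · have hX : Module.finrank K X = i + 1 := hX.2
        have hi := (splits_geometryD_plus_minus_iff i).1 ht
        exact Or.inr (Or.inr ⟨X, hXr, by omega,
          le_of_comparable_of_finrank_le (comparable_of_inc_left (hn := hn) (hinc ⟨_, Or.inl rfl⟩)) (by omega),
          le_of_comparable_of_finrank_le (comparable_of_inc_left (hn := hn) (hinc ⟨_, Or.inr rfl⟩)) (by omega)⟩)
      · exact absurd (Or.inl rfl) ht.1
      · exact absurd (Or.inr rfl) ht.1
  · rintro (h | h | ⟨X, hXr, hXd, hXM, hXM'⟩)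
    · exact Or.inl ⟨_, h⟩
    · exact Or.inl ⟨_, h⟩
    have hMs := geometryD_flag_isTotallySingular F ⟨.plus, Or.inl rfl⟩
    refine Or.inr ⟨.low ⟨n - 3, by omega⟩, X, ?_, ⟨hMs.mono hXM, ?_⟩, hXr, ?_⟩
    · exact (splits_geometryD_plus_minus_iff _).2 (show n - 3 + 3 = n by omega)
    · show Module.finrank K X = n - 3 + 1
      omega
    · rintro ⟨j, rfl | rfl⟩
      · exact Or.inl hXM
      · exact Or.inl hXM'

end TypeD

/-! ### The subspace property in `D_n` -/

section TypeD

variable {K : Type u} {V : Type*} [Field K] [AddCommGroup V] [Module K V] {n : ℕ}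
  {hn : 3 ≤ n} {q : QuadraticForm K V} {E : Module.Basis (Fin n × Fin 2) K V}
  {M₀ : Submodule K V} {K₀ : Subfield K}

theorem HasCanonicalForm.isSubspace_omega_one_minus (hq : HasCanonicalForm q E)
    (hM₀ : IsTotallySingular q M₀) (hM₀n : Module.finrank K M₀ = n) :
    ((geometryD hn q M₀).Gr {DNode.one hn, DNode.minus}).IsSubspace
      ((geometryD hn q M₀).Omega E K₀ {DNode.one hn, DNode.minus}) := by
  have := Module.Finite.of_basis E
  intro l (P : (geometryD hn q M₀).Flag _) (P' : (geometryD hn q M₀).Flag _)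
    hne hP hP' hPl hPl' (R : (geometryD hn q M₀).Flag _) hRl
  obtain ⟨X, hX, hpX, hXM⟩ := (hq.mem_omega_one_minus_iff P).1 hP
  obtain ⟨X', hX', hpX', hXM'⟩ := (hq.mem_omega_one_minus_iff P').1 hP'
  refine (hq.mem_omega_one_minus_iff R).2 ?_
  have heq := fun i hi => SubspaceGeometry.Gr.elem_eq hPl hRl i hi
  have heq' := fun i hi => SubspaceGeometry.Gr.elem_eq hPl' hRl i hi
  obtain ⟨⟨j, rfl | rfl⟩, L⟩ := l
  · refine ⟨X ⊔ X', hX.sup hX', ?_, sup_le ?_ ?_⟩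
    · exact (geometryD_one_le_sup (Or.inl rfl) rfl hne hPl hPl' hRl).trans (sup_le_sup hpX hpX')
    · rwa [← heq ⟨.minus, Or.inr rfl⟩ (fun h => nomatch congrArg Subtype.val h)]
    · rwa [← heq' ⟨.minus, Or.inr rfl⟩ (fun h => nomatch congrArg Subtype.val h)]
  · obtain ⟨-, hU⟩ := hq.line_inf hM₀ hM₀n (Or.inr rfl) hne hPl hPl'
    refine ⟨X ⊓ X', hX.inf hX', le_inf ?_ ?_, ?_⟩
    · rwa [← heq ⟨_, Or.inl rfl⟩ (fun h => nomatch congrArg Subtype.val h)]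
    · rwa [← heq' ⟨_, Or.inl rfl⟩ (fun h => nomatch congrArg Subtype.val h)]
    · exact (inf_le_inf hXM hXM').trans ((hU R hRl).1 _ (Or.inr rfl))

/-- Exchanges the roles of `+` and `-`; `c` stands for containing the 1-space or for having
dimension `n - 2`. -/
theorem isRational_or_swap {A B : Submodule K V} {c : Submodule K V → Prop}
    (h : IsRationalSubspace E K₀ A ∨ IsRationalSubspace E K₀ B ∨
      ∃ X, IsRationalSubspace E K₀ X ∧ c X ∧ X ≤ A ∧ X ≤ B) :
    IsRationalSubspace E K₀ B ∨ IsRationalSubspace E K₀ A ∨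
      ∃ X, IsRationalSubspace E K₀ X ∧ c X ∧ X ≤ B ∧ X ≤ A := by
  rcases h with h | h | ⟨X, hX, hc, hA, hB⟩
  · exact Or.inr (Or.inl h)
  · exact Or.inl h
  · exact Or.inr (Or.inr ⟨X, hX, hc, hB, hA⟩)

/-- Here `M`, `M'`, `M''` are the varying maximal elements of three points on a line and `N` is the
fixed one. If `N` is not rational, each hypothesis gives a rational subspace between `p` and the
varying element, possibly that element itself. Their intersection lies in `M ⊓ M'`, hence in `M''`
and in `N`. -/
theorem isRational_or_exists_of_inf {p M M' M'' N : Submodule K V}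
    (hp : p ≤ M) (hp' : p ≤ M')
    (hM'' : M ⊓ M' ≤ M'') (hN : M ⊓ M' ≤ N)
    (h : IsRationalSubspace E K₀ M ∨ IsRationalSubspace E K₀ N ∨
      ∃ X, IsRationalSubspace E K₀ X ∧ p ≤ X ∧ X ≤ M ∧ X ≤ N)
    (h' : IsRationalSubspace E K₀ M' ∨ IsRationalSubspace E K₀ N ∨
      ∃ X, IsRationalSubspace E K₀ X ∧ p ≤ X ∧ X ≤ M' ∧ X ≤ N) :
    IsRationalSubspace E K₀ N ∨ ∃ X, IsRationalSubspace E K₀ X ∧ p ≤ X ∧ X ≤ M'' ∧ X ≤ N := by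
  by_cases hNr : IsRationalSubspace E K₀ N
  · exact Or.inl hNr
  have aux : ∀ {M : Submodule K V}, p ≤ M → (IsRationalSubspace E K₀ M ∨
      IsRationalSubspace E K₀ N ∨ ∃ X, IsRationalSubspace E K₀ X ∧ p ≤ X ∧ X ≤ M ∧ X ≤ N) →
      ∃ X, IsRationalSubspace E K₀ X ∧ p ≤ X ∧ X ≤ M := by
    rintro M hp (h | h | ⟨X, hX, hpX, hXM, -⟩)
    · exact ⟨M, h, hp, le_rfl⟩
    · exact absurd h hNr
    · exact ⟨X, hX, hpX, hXM⟩
  obtain ⟨X, hX, hpX, hXM⟩ := aux hp h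
  obtain ⟨X', hX', hpX', hXM'⟩ := aux hp' h'
  have hle := inf_le_inf hXM hXM'
  exact Or.inr ⟨X ⊓ X', hX.inf hX', le_inf hpX hpX', hle.trans hM'', hle.trans hN⟩

theorem HasCanonicalForm.isSubspace_omega_one_plus_minus (hq : HasCanonicalForm q E)
    (hM₀ : IsTotallySingular q M₀) (hM₀n : Module.finrank K M₀ = n) :
    ((geometryD hn q M₀).Gr {DNode.one hn, DNode.plus, DNode.minus}).IsSubspace
      ((geometryD hn q M₀).Omega E K₀ {DNode.one hn, DNode.plus, DNode.minus}) := by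
  have := Module.Finite.of_basis E
  intro l (P : (geometryD hn q M₀).Flag _) (P' : (geometryD hn q M₀).Flag _)
    hne hP hP' hPl hPl' (R : (geometryD hn q M₀).Flag _) hRl
  have h := (hq.mem_omega_one_plus_minus_iff P).1 hP
  have h' := (hq.mem_omega_one_plus_minus_iff P').1 hP'
  refine (hq.mem_omega_one_plus_minus_iff R).2 ?_
  have heq := fun i hi => SubspaceGeometry.Gr.elem_eq hPl hRl i hi
  have heq' := fun i hi => SubspaceGeometry.Gr.elem_eq hPl' hRl i hi
  obtain ⟨⟨j, rfl | rfl | rfl⟩, L⟩ := l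
  · rw [heq ⟨.plus, Or.inr (Or.inl rfl)⟩ (fun h => nomatch congrArg Subtype.val h),
      heq ⟨.minus, Or.inr (Or.inr rfl)⟩ (fun h => nomatch congrArg Subtype.val h)] at h
    rw [heq' ⟨.plus, Or.inr (Or.inl rfl)⟩ (fun h => nomatch congrArg Subtype.val h),
      heq' ⟨.minus, Or.inr (Or.inr rfl)⟩ (fun h => nomatch congrArg Subtype.val h)] at h'
    rcases h with h | h | ⟨X, hX, hpX, hXM, hXN⟩
    · exact Or.inl h
    · exact Or.inr (Or.inl h)
    rcases h' with h' | h' | ⟨X', hX', hpX', hXM', hXN'⟩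
    · exact Or.inl h'
    · exact Or.inr (Or.inl h')
    refine Or.inr (Or.inr ⟨X ⊔ X', hX.sup hX', ?_, sup_le hXM hXM', sup_le hXN hXN'⟩)
    exact (geometryD_one_le_sup (Or.inl rfl) rfl hne hPl hPl' hRl).trans (sup_le_sup hpX hpX')
  · obtain ⟨-, hU⟩ := hq.line_inf hM₀ hM₀n (Or.inl rfl) hne hPl hPl'
    have hp := (hU R hRl).2 (Or.inl rfl)
    rw [heq ⟨_, Or.inl rfl⟩ (fun h => nomatch congrArg Subtype.val h),
      heq ⟨.minus, Or.inr (Or.inr rfl)⟩ (fun h => nomatch congrArg Subtype.val h)] at h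
    rw [heq' ⟨_, Or.inl rfl⟩ (fun h => nomatch congrArg Subtype.val h),
      heq' ⟨.minus, Or.inr (Or.inr rfl)⟩ (fun h => nomatch congrArg Subtype.val h)] at h'
    exact Or.inr (isRational_or_exists_of_inf (hp.trans inf_le_left) (hp.trans inf_le_right)
      ((hU R hRl).1 ⟨.plus, _⟩ (Or.inl rfl)) ((hU R hRl).1 ⟨.minus, _⟩ (Or.inr rfl)) h h')
  · obtain ⟨-, hU⟩ := hq.line_inf hM₀ hM₀n (Or.inr rfl) hne hPl hPl'
    have hp := (hU R hRl).2 (Or.inl rfl)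
    rw [heq ⟨_, Or.inl rfl⟩ (fun h => nomatch congrArg Subtype.val h),
      heq ⟨.plus, Or.inr (Or.inl rfl)⟩ (fun h => nomatch congrArg Subtype.val h)] at h
    rw [heq' ⟨_, Or.inl rfl⟩ (fun h => nomatch congrArg Subtype.val h),
      heq' ⟨.plus, Or.inr (Or.inl rfl)⟩ (fun h => nomatch congrArg Subtype.val h)] at h'
    have hU1 := (hU R hRl).1 ⟨.minus, Or.inr (Or.inr rfl)⟩ (Or.inr rfl)
    have hU2 := (hU R hRl).1 ⟨.plus, Or.inr (Or.inl rfl)⟩ (Or.inl rfl)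
    exact isRational_or_swap (Or.inr (isRational_or_exists_of_inf (hp.trans inf_le_left)
      (hp.trans inf_le_right) hU1 hU2 (isRational_or_swap h) (isRational_or_swap h')))

/-- If `M` and `X'` are rational and `X'` is a subspace of dimension `n - 2` of `N`, then `N` is
rational or `X'` is in `M`. -/
theorem HasCanonicalForm.isRational_or_le (hq : HasCanonicalForm q E) {M N X' : Submodule K V}
    (hM : IsTotallySingular q M) (hMn : Module.finrank K M = n)
    (hN : IsTotallySingular q N) (hNn : Module.finrank K N = n)
    (hMN : Module.finrank K (M ⊓ N : Submodule K V) = n - 1)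
    (hMr : IsRationalSubspace E K₀ M) (hX' : IsRationalSubspace E K₀ X')
    (hXd' : Module.finrank K X' + 2 = n) (hXN' : X' ≤ N) :
    IsRationalSubspace E K₀ N ∨ X' ≤ M := by
  have := Module.Finite.of_basis E
  by_contra! hcon
  have h1 := hq.finrank_polarPerp_inf (X := X') hM hMn
  have h2 := Submodule.finrank_lt_finrank_of_lt (inf_lt_left.2 hcon.2)
  have h3 : M ⊓ N ≤ polarPerp q X' ⊓ M :=
    le_inf (inf_le_right.trans (hN.le_polarPerp.trans (polarPerp_anti hXN'))) inf_le_left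
  -- If `X'` is not in `M`, then `X' ⊓ M` has dimension at most `n - 3`, so the right side of `h3`
  -- has dimension at most `n - 1`. Equality makes `M ⊓ N` a rational hyperplane of `N`.
  have h4 := Submodule.eq_of_le_of_finrank_le h3 (by omega)
  have h5 := (hX'.polarPerp hq).inf hMr
  rw [← h4] at h5
  exact hcon.1 (hq.isRationalSubspace_of_le h5 hN hNn inf_le_right (by omega))

/-- The witness must have dimension `n - 2`. If `N` is not rational, it is `M ⊓ M'` when both are
rational. When only one is known to be rational, `HasCanonicalForm.isRational_or_le` puts the other
point's witness into it. Finally, two distinct witnesses in `N` would have a sum of dimension at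
least `n - 1`, making `N` rational, so they agree. -/
theorem HasCanonicalForm.isRational_or_exists_of_inf (hq : HasCanonicalForm q E)
    {M M' M'' N : Submodule K V}
    (hM : IsTotallySingular q M) (hMn : Module.finrank K M = n)
    (hM' : IsTotallySingular q M') (hMn' : Module.finrank K M' = n)
    (hN : IsTotallySingular q N) (hNn : Module.finrank K N = n)
    (hMN : Module.finrank K (M ⊓ N : Submodule K V) = n - 1)
    (hMN' : Module.finrank K (M' ⊓ N : Submodule K V) = n - 1)
    (hd : Module.finrank K (M ⊓ M' : Submodule K V) + 2 = n)
    (hUM : M ⊓ M' ≤ M'') (hUN : M ⊓ M' ≤ N)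
    (h : IsRationalSubspace E K₀ M ∨ IsRationalSubspace E K₀ N ∨
      ∃ X, IsRationalSubspace E K₀ X ∧ Module.finrank K X + 2 = n ∧ X ≤ M ∧ X ≤ N)
    (h' : IsRationalSubspace E K₀ M' ∨ IsRationalSubspace E K₀ N ∨
      ∃ X, IsRationalSubspace E K₀ X ∧ Module.finrank K X + 2 = n ∧ X ≤ M' ∧ X ≤ N) :
    IsRationalSubspace E K₀ N ∨
      ∃ X, IsRationalSubspace E K₀ X ∧ Module.finrank K X + 2 = n ∧ X ≤ M'' ∧ X ≤ N := by
  have := Module.Finite.of_basis E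
  by_cases hNr : IsRationalSubspace E K₀ N
  · exact Or.inl hNr
  have aux : ∀ X, IsRationalSubspace E K₀ X → X ≤ M → X ≤ M' → Module.finrank K X + 2 = n →
      ∃ X, IsRationalSubspace E K₀ X ∧ Module.finrank K X + 2 = n ∧ X ≤ M'' ∧ X ≤ N :=
    fun X hX h1 h2 hXd => ⟨X, hX, hXd, (le_inf h1 h2).trans hUM, (le_inf h1 h2).trans hUN⟩
  refine Or.inr ?_
  rcases h with h | h | ⟨X, hX, hXd, hXM, hXN⟩
  · rcases h' with h' | h' | ⟨X', hX', hXd', hXM', hXN'⟩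
    · exact ⟨M ⊓ M', h.inf h', hd, hUM, hUN⟩
    · exact absurd h' hNr
    · exact aux X' hX' ((hq.isRational_or_le hM hMn hN hNn hMN h hX' hXd' hXN').resolve_left hNr)
        hXM' hXd'
  · exact absurd h hNr
  · rcases h' with h' | h' | ⟨X', hX', hXd', hXM', hXN'⟩
    · exact aux X hX hXM
        ((hq.isRational_or_le hM' hMn' hN hNn hMN' h' hX hXd hXN).resolve_left hNr) hXd
    · exact absurd h' hNr
    · by_cases hle : X ≤ X'
      · exact aux X hX hXM (hle.trans hXM') hXd
      · refine absurd (hq.isRationalSubspace_of_le (hX.sup hX') hN hNn (sup_le hXN hXN') ?_) hNr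
        have := Submodule.finrank_lt_finrank_of_lt (right_lt_sup.2 hle)
        omega

theorem HasCanonicalForm.isSubspace_omega_plus_minus (hq : HasCanonicalForm q E)
    (hM₀ : IsTotallySingular q M₀) (hM₀n : Module.finrank K M₀ = n) :
    ((geometryD hn q M₀).Gr {DNode.plus, DNode.minus}).IsSubspace
      ((geometryD hn q M₀).Omega E K₀ {DNode.plus, DNode.minus}) := by
  have := Module.Finite.of_basis E
  intro l (P : (geometryD hn q M₀).Flag _) (P' : (geometryD hn q M₀).Flag _)
    hne hP hP' hPl hPl' (R : (geometryD hn q M₀).Flag _) hRl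
  have h := (mem_omega_plus_minus_iff E P).1 hP
  have h' := (mem_omega_plus_minus_iff E P').1 hP'
  refine (mem_omega_plus_minus_iff E R).2 ?_
  have heq := fun i hi => SubspaceGeometry.Gr.elem_eq hPl hRl i hi
  have heq' := fun i hi => SubspaceGeometry.Gr.elem_eq hPl' hRl i hi
  have hd := geometryD_flag_finrank_inf P (Or.inl rfl) (Or.inr rfl)
  have hd' := geometryD_flag_finrank_inf P' (Or.inl rfl) (Or.inr rfl)
  have hs := fun F : (geometryD hn q M₀).Flag {DNode.plus, DNode.minus} =>
    geometryD_flag_isTotallySingular F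
  obtain ⟨⟨j, rfl | rfl⟩, L⟩ := l
  · obtain ⟨hUd, hU⟩ := hq.line_inf hM₀ hM₀n (Or.inl rfl) hne hPl hPl'
    rw [heq ⟨.minus, Or.inr rfl⟩ (fun h => nomatch congrArg Subtype.val h)] at h hd
    rw [heq' ⟨.minus, Or.inr rfl⟩ (fun h => nomatch congrArg Subtype.val h)] at h' hd'
    exact Or.inr (hq.isRational_or_exists_of_inf (hs P _)
      (geometryD_flag_finrank P (Or.inl rfl)) (hs P' _)
      (geometryD_flag_finrank P' (Or.inl rfl)) (hs R _)
      (geometryD_flag_finrank R (Or.inr rfl)) hd hd' hUd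
      ((hU R hRl).1 ⟨.plus, _⟩ (Or.inl rfl)) ((hU R hRl).1 ⟨.minus, _⟩ (Or.inr rfl)) h h')
  · obtain ⟨hUd, hU⟩ := hq.line_inf hM₀ hM₀n (Or.inr rfl) hne hPl hPl'
    rw [heq ⟨.plus, Or.inl rfl⟩ (fun h => nomatch congrArg Subtype.val h)] at h hd
    rw [heq' ⟨.plus, Or.inl rfl⟩ (fun h => nomatch congrArg Subtype.val h)] at h' hd'
    rw [inf_comm] at hd hd'
    exact isRational_or_swap (Or.inr (hq.isRational_or_exists_of_inf (hs P _)
      (geometryD_flag_finrank P (Or.inr rfl)) (hs P' _)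
      (geometryD_flag_finrank P' (Or.inr rfl)) (hs R _)
      (geometryD_flag_finrank R (Or.inl rfl)) hd hd' hUd
      ((hU R hRl).1 ⟨.minus, _⟩ (Or.inr rfl)) ((hU R hRl).1 ⟨.plus, _⟩ (Or.inl rfl))
      (isRational_or_swap h) (isRational_or_swap h')))

end TypeD

/-! ### A flag that is not nearly rational -/

section TypeD

variable {K : Type u} {V : Type*} [Field K] [AddCommGroup V] [Module K V] {n : ℕ}

/-- A linear map whose kernel is the maximal totally singular subspace spanned by
`E (i₀, 0) + a • E (i₁, 0)`, `a • E (i₀, 1) - E (i₁, 1)` and, for each of the other `i`, one of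
`E (i, 0)` and `E (i, 1)`, the one with vanishing coordinate `(i, σ i)`. -/
noncomputable def skewMap (E : Module.Basis (Fin n × Fin 2) K V) (i₀ i₁ : Fin n) (a : K)
    (σ : Fin n → Fin 2) : V →ₗ[K] (Fin n → K) :=
  LinearMap.pi fun i =>
    if i = i₀ then E.coord (i₁, 0) - a • E.coord (i₀, 0)
    else if i = i₁ then E.coord (i₀, 1) + a • E.coord (i₁, 1)
    else E.coord (i, σ i)

variable {q : QuadraticForm K V} {E : Module.Basis (Fin n × Fin 2) K V} {i₀ i₁ : Fin n} {a : K}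
  {σ : Fin n → Fin 2} {K₀ : Subfield K}

theorem mem_ker_skewMap (h : i₀ ≠ i₁) {x : V} :
    x ∈ LinearMap.ker (skewMap E i₀ i₁ a σ) ↔
      E.repr x (i₁, 0) = a * E.repr x (i₀, 0) ∧ E.repr x (i₀, 1) = -(a * E.repr x (i₁, 1)) ∧
        ∀ i, i ≠ i₀ → i ≠ i₁ → E.repr x (i, σ i) = 0 := by
  rw [LinearMap.mem_ker]
  constructor
  · intro hx
    have hx := congrFun hx
    simp only [skewMap, LinearMap.pi_apply, Pi.zero_apply] at hx
    refine ⟨?_, ?_, fun i hi hi' => ?_⟩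
    · have := hx i₀
      rw [if_pos rfl] at this
      exact sub_eq_zero.1 this
    · have := hx i₁
      rw [if_neg h.symm, if_pos rfl] at this
      exact eq_neg_of_add_eq_zero_left this
    · have := hx i
      rwa [if_neg hi, if_neg hi'] at this
  · rintro ⟨h0, h1, h2⟩
    funext i
    simp only [skewMap, LinearMap.pi_apply, Pi.zero_apply]
    split_ifs with hi hi'
    · exact sub_eq_zero.2 h0
    · exact add_eq_zero_iff_eq_neg.2 h1
    · exact h2 i hi hi'

theorem HasCanonicalForm.isTotallySingular_ker_skewMap (hq : HasCanonicalForm q E) (h : i₀ ≠ i₁) :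
    IsTotallySingular q (LinearMap.ker (skewMap E i₀ i₁ a σ)) := by
  intro x hx
  obtain ⟨h0, h1, h2⟩ := (mem_ker_skewMap h).1 hx
  rw [hq, Fintype.sum_eq_add i₀ i₁ h, h0, h1]
  · ring
  · rintro i ⟨hi, hi'⟩
    have := h2 i hi hi'
    rcases Fin.exists_fin_two.1 ⟨σ i, rfl⟩ with hσ | hσ <;> rw [hσ] at this <;> simp [this]

/-- Rank-nullity bounds the dimension below by `n`; total singularity bounds it above. -/
theorem HasCanonicalForm.finrank_ker_skewMap (hq : HasCanonicalForm q E) (h : i₀ ≠ i₁) :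
    Module.finrank K (LinearMap.ker (skewMap E i₀ i₁ a σ)) = n := by
  have := Module.Finite.of_basis E
  have h1 := Submodule.finrank_mono
    (hq.isTotallySingular_ker_skewMap (a := a) (σ := σ) h).le_polarPerp
  rw [hq.finrank_polarPerp] at h1
  have h2 := LinearMap.finrank_range_add_finrank_ker (skewMap E i₀ i₁ a σ)
  have h3 := Submodule.finrank_le (LinearMap.range (skewMap E i₀ i₁ a σ))
  rw [finrank_eq_two_mul_of_basis E] at h2
  rw [Module.finrank_fin_fun] at h3
  omega

theorem repr_eq_zero_of_mem_ker_skewMap (ha : a ∉ K₀) (h : i₀ ≠ i₁) {x : V}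
    (hx : x ∈ LinearMap.ker (skewMap E i₀ i₁ a σ)) (hxr : IsRationalVector E K₀ x) :
    E.repr x (i₀, 0) = 0 ∧ E.repr x (i₁, 1) = 0 := by
  obtain ⟨h0, h1, -⟩ := (mem_ker_skewMap h).1 hx
  constructor <;> by_contra hne <;> refine ha ?_
  · rw [← mul_inv_cancel_right₀ hne a, ← h0]
    exact K₀.mul_mem (hxr _) (K₀.inv_mem (hxr _))
  · rw [← mul_inv_cancel_right₀ hne a, ← neg_eq_iff_eq_neg.2 h1]
    exact K₀.mul_mem (K₀.neg_mem (hxr _)) (K₀.inv_mem (hxr _))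

theorem IsRationalSubspace.repr_eq_zero_of_le_ker_skewMap (ha : a ∉ K₀) (h : i₀ ≠ i₁)
    {X : Submodule K V} (hX : IsRationalSubspace E K₀ X)
    (hle : X ≤ LinearMap.ker (skewMap E i₀ i₁ a σ)) {x : V} (hx : x ∈ X) :
    E.repr x (i₀, 0) = 0 ∧ E.repr x (i₁, 1) = 0 := by
  have : X ≤ LinearMap.ker (E.coord (i₀, 0)) ⊓ LinearMap.ker (E.coord (i₁, 1)) :=
    hX.le_of_forall fun x hx hxr => repr_eq_zero_of_mem_ker_skewMap ha h (hle hx) hxr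
  exact this hx

/-- The two maximal subspaces are kernels of `skewMap` that differ only in the pair `i₂`, where one
contains `E (i₂, 0)` and the other `E (i₂, 1)`. Rational subspaces of either miss `y`, whose `(i₀,
0)`-coordinate is 1. -/
theorem HasCanonicalForm.exists_not_rational (hq : HasCanonicalForm q E) (hn : 3 ≤ n)
    (hK₀ : K₀ ≠ ⊤) :
    ∃ p M M' : Submodule K V, Module.finrank K p = 1 ∧ p ≤ M ∧ p ≤ M' ∧
      IsTotallySingular q M ∧ Module.finrank K M = n ∧
      IsTotallySingular q M' ∧ Module.finrank K M' = n ∧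
      Module.finrank K (M ⊓ M' : Submodule K V) + 1 = n ∧
      (∀ X, IsRationalSubspace E K₀ X → X ≤ M → ¬ p ≤ X) ∧
      (∀ X, IsRationalSubspace E K₀ X → X ≤ M' → ¬ p ≤ X) ∧
      ∀ X, IsRationalSubspace E K₀ X → X ≤ M → X ≤ M' → Module.finrank K X + 2 ≠ n := by
  classical
  have := Module.Finite.of_basis E
  obtain ⟨a, -, ha⟩ := SetLike.exists_of_lt (lt_top_iff_ne_top.2 hK₀)
  let i₀ : Fin n := ⟨0, by omega⟩
  let i₁ : Fin n := ⟨1, by omega⟩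
  let i₂ : Fin n := ⟨2, by omega⟩
  have h01 : i₀ ≠ i₁ := by simp [i₀, i₁]
  have h02 : i₂ ≠ i₀ := by simp [i₀, i₂]
  have h12 : i₂ ≠ i₁ := by simp [i₁, i₂]
  let y : V := E (i₀, 0) + a • E (i₁, 0)
  let σ : Fin n → Fin 2 := fun _ => 1
  let σ' : Fin n → Fin 2 := Function.update σ i₂ 0
  have hy : ∀ τ : Fin n → Fin 2, y ∈ LinearMap.ker (skewMap E i₀ i₁ a τ) := by
    intro τ
    refine (mem_ker_skewMap h01).2 ⟨?_, ?_, fun i hi hi' => ?_⟩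
    · simp [y, h01, h01.symm]
    · simp [y]
    · simp [y, hi.symm, hi'.symm]
  have hy0 : E.repr y (i₀, 0) = 1 := by simp [y, h01.symm]
  have hyX : ∀ (τ : Fin n → Fin 2) X, IsRationalSubspace E K₀ X →
      X ≤ LinearMap.ker (skewMap E i₀ i₁ a τ) → ¬ Submodule.span K {y} ≤ X := by
    intro τ X hX hle hyX
    have := hX.repr_eq_zero_of_le_ker_skewMap ha h01 hle
      (hyX (Submodule.mem_span_singleton_self y))
    exact one_ne_zero (hy0.symm.trans this.1)
  refine ⟨Submodule.span K {y}, LinearMap.ker (skewMap E i₀ i₁ a σ),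
    LinearMap.ker (skewMap E i₀ i₁ a σ'),
    finrank_span_singleton (by intro h; simp [h] at hy0),
    (Submodule.span_singleton_le_iff_mem _ _).2 (hy σ),
    (Submodule.span_singleton_le_iff_mem _ _).2 (hy σ'),
    hq.isTotallySingular_ker_skewMap h01, hq.finrank_ker_skewMap h01,
    hq.isTotallySingular_ker_skewMap h01, hq.finrank_ker_skewMap h01, ?_, hyX σ, hyX σ', ?_⟩
  · have h1 : LinearMap.ker (skewMap E i₀ i₁ a σ) ⊓ LinearMap.ker (E.coord (i₂, 0)) ≤
        LinearMap.ker (skewMap E i₀ i₁ a σ) ⊓ LinearMap.ker (skewMap E i₀ i₁ a σ') := by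
      refine le_inf inf_le_left fun x hx => ?_
      obtain ⟨h0, h1, h2⟩ := (mem_ker_skewMap h01).1 hx.1
      refine (mem_ker_skewMap h01).2 ⟨h0, h1, fun i hi hi' => ?_⟩
      by_cases h : i = i₂
      · subst h
        rw [show σ' i₂ = 0 from Function.update_self ..]
        exact hx.2
      · rw [show σ' i = σ i from Function.update_of_ne h ..]
        exact h2 i hi hi'
    have h2 : LinearMap.ker (skewMap E i₀ i₁ a σ) ⊓ LinearMap.ker (skewMap E i₀ i₁ a σ') <
        LinearMap.ker (skewMap E i₀ i₁ a σ) := by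
      refine inf_lt_left.2 fun hle => ?_
      have hmem : E (i₂, 0) ∈ LinearMap.ker (skewMap E i₀ i₁ a σ) :=
        (mem_ker_skewMap h01).2 (by simp [h02, h12, σ])
      have := ((mem_ker_skewMap h01).1 (hle hmem)).2.2 i₂ h02 h12
      simp [σ'] at this
    have h3 := Submodule.finrank_mono h1
    have h4 := Submodule.finrank_lt_finrank_of_lt h2
    have h5 := Submodule.finrank_sup_add_finrank_inf_eq (LinearMap.ker (skewMap E i₀ i₁ a σ))
      (LinearMap.ker (E.coord (i₂, 0)))
    have h6 := Submodule.finrank_le (LinearMap.ker (skewMap E i₀ i₁ a σ) ⊔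
      LinearMap.ker (E.coord (i₂, 0)))
    have h7 := LinearMap.finrank_range_add_finrank_ker (E.coord (i₂, 0))
    have h8 := Submodule.finrank_le (LinearMap.range (E.coord (i₂, 0)))
    rw [Module.finrank_self] at h8
    rw [hq.finrank_ker_skewMap h01] at h4 h5
    rw [finrank_eq_two_mul_of_basis E] at h6 h7
    omega
  · intro X hX hXM hXM'
    -- A rational `X` in both kernels has zero coordinates at the three pairs `i₀`, `i₁`, `i₂`, and
    -- at `(i, 1)` for the other `i`. The remaining `n - 3` coordinates determine its vectors, so
    -- its dimension is at most `n - 3`.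
    let f : X →ₗ[K] (Fin (n - 3) → K) :=
      (LinearMap.pi fun i : Fin (n - 3) => E.coord (⟨i + 3, by omega⟩, 0)).comp X.subtype
    have hf : Function.Injective f := by
      rw [← LinearMap.ker_eq_bot, LinearMap.ker_eq_bot']
      rintro ⟨x, hx⟩ hfx
      have hfx : ∀ i : Fin (n - 3), E.repr x (⟨i + 3, by omega⟩, 0) = 0 := congrFun hfx
      obtain ⟨hx0, hx1⟩ := hX.repr_eq_zero_of_le_ker_skewMap ha h01 hXM hx
      obtain ⟨h0, h1, h2⟩ := (mem_ker_skewMap h01).1 (hXM hx)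
      have h2' := ((mem_ker_skewMap h01).1 (hXM' hx)).2.2 i₂ h02 h12
      rw [show σ' i₂ = 0 from Function.update_self ..] at h2'
      rw [hx0, mul_zero] at h0
      rw [hx1, mul_zero, neg_zero] at h1
      refine Subtype.ext (E.ext_elem fun ⟨i, j⟩ => ?_)
      change E.repr x (i, j) = E.repr 0 (i, j)
      rw [map_zero, Finsupp.zero_apply]
      by_cases hi0 : i = i₀
      · subst hi0
        fin_cases j
        · exact hx0
        · exact h1
      by_cases hi1 : i = i₁
      · subst hi1
        fin_cases j
        · exact h0
        · exact hx1
      fin_cases j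
      · by_cases hi2 : i = i₂
        · subst hi2
          exact h2'
        · have hi : 3 ≤ (i : ℕ) := by
            simp only [i₀, i₁, i₂, Fin.ext_iff] at hi0 hi1 hi2
            omega
          have h := hfx ⟨i - 3, by omega⟩
          have hii : (⟨(i : ℕ) - 3 + 3, by omega⟩ : Fin n) = i :=
            Fin.ext (Nat.sub_add_cancel hi)
          change E.repr x (⟨(i : ℕ) - 3 + 3, _⟩, 0) = 0 at h
          rwa [hii] at h
      · exact h2 i hi0 hi1
    have := LinearMap.finrank_le_finrank_of_injective hf
    rw [Module.finrank_fin_fun] at this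
    omega

theorem HasCanonicalForm.exists_flag (hq : HasCanonicalForm q E) (hn : 3 ≤ n)
    {M₀ : Submodule K V} (hM₀ : IsTotallySingular q M₀) (hM₀n : Module.finrank K M₀ = n)
    (hK₀ : K₀ ≠ ⊤) {J : Set (DNode n)} (hJ : J ⊆ {DNode.one hn, DNode.plus, DNode.minus}) :
    ∃ (F : (geometryD hn q M₀).Flag J) (p M M' : Submodule K V),
      (∀ h, F.elem ⟨DNode.one hn, h⟩ = p) ∧ (∀ h, F.elem ⟨.plus, h⟩ = M) ∧
      (∀ h, F.elem ⟨.minus, h⟩ = M') ∧ p ≤ M ∧ p ≤ M' ∧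
      (∀ X, IsRationalSubspace E K₀ X → X ≤ M → ¬ p ≤ X) ∧
      (∀ X, IsRationalSubspace E K₀ X → X ≤ M' → ¬ p ≤ X) ∧
      ∀ X, IsRationalSubspace E K₀ X → X ≤ M → X ≤ M' → Module.finrank K X + 2 ≠ n := by
  obtain ⟨p, M, M', hpd, hpM, hpM', hM, hMn, hM', hMn', hd, h1, h2, h3⟩ :=
    hq.exists_not_rational hn hK₀
  -- Exactly one of the two subspaces is in the family of `M₀`, and the properties obtained are
  -- symmetric in them.
  wlog hfam : SameFamily M M₀ generalizing M M'
  · refine this M' M hpM' hpM hM' hMn' hM hMn (by rwa [inf_comm]) h2 h1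
      (fun X hX hX1 hX2 => h3 X hX hX2 hX1) ?_
    by_contra hcon
    exact hfam ((hq.sameFamily_iff_not hM hMn hM' hMn' hM₀ hM₀n hd).2 hcon)
  have hfam' := (hq.sameFamily_iff_not hM hMn hM' hMn' hM₀ hM₀n hd).1 hfam
  let F : (geometryD hn q M₀).Flag J :=
    { elem := fun j => match (j : DNode n) with
        | .low _ => p
        | .plus => M
        | .minus => M'
      isElem := by
        rintro ⟨j, hj⟩
        rcases hJ hj with rfl | rfl | rfl
        · exact ⟨hM.mono hpM, hpd⟩
        · exact ⟨hM, hMn, hfam⟩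
        · exact ⟨hM', hMn', hfam'⟩
      inc := by
        rintro ⟨i, hi⟩ ⟨j, hj⟩
        rcases hJ hi with rfl | rfl | rfl <;> rcases hJ hj with rfl | rfl | rfl
        · exact Or.inl le_rfl
        · exact Or.inl hpM
        · exact Or.inl hpM'
        · exact Or.inr hpM
        · exact Or.inl le_rfl
        · exact (show Module.finrank K (M ⊓ M' : Submodule K V) = n - 1 by omega)
        · exact Or.inr hpM'
        · rw [inf_comm] at hd
          exact (show Module.finrank K (M' ⊓ M : Submodule K V) = n - 1 by omega)
        · exact Or.inl le_rfl }
  exact ⟨F, p, M, M', fun _ => rfl, fun _ => rfl, fun _ => rfl, hpM, hpM', h1, h2, h3⟩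

theorem HasCanonicalForm.omega_one_minus_ne_univ (hq : HasCanonicalForm q E) (hn : 3 ≤ n)
    {M₀ : Submodule K V} (hM₀ : IsTotallySingular q M₀) (hM₀n : Module.finrank K M₀ = n)
    (hK₀ : K₀ ≠ ⊤) :
    (geometryD hn q M₀).Omega E K₀ {DNode.one hn, DNode.minus} ≠ Set.univ := by
  intro huniv
  obtain ⟨F, p, M, M', hFp, -, hFM', -, -, -, h2, -⟩ :=
    hq.exists_flag hn hM₀ hM₀n hK₀ (J := {DNode.one hn, DNode.minus})
      (Set.insert_subset_insert (Set.subset_insert _ _))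
  obtain ⟨X, hX, hpX, hXM⟩ := (hq.mem_omega_one_minus_iff F).1 (huniv ▸ Set.mem_univ F)
  exact h2 X hX (hXM.trans (hFM' _).le) ((hFp _).ge.trans hpX)

theorem HasCanonicalForm.omega_one_plus_minus_ne_univ (hq : HasCanonicalForm q E) (hn : 3 ≤ n)
    {M₀ : Submodule K V} (hM₀ : IsTotallySingular q M₀) (hM₀n : Module.finrank K M₀ = n)
    (hK₀ : K₀ ≠ ⊤) :
    (geometryD hn q M₀).Omega E K₀ {DNode.one hn, DNode.plus, DNode.minus} ≠ Set.univ := by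
  intro huniv
  obtain ⟨F, p, M, M', hFp, hFM, hFM', hpM, hpM', h1, h2, -⟩ :=
    hq.exists_flag hn hM₀ hM₀n hK₀ subset_rfl
  rcases (hq.mem_omega_one_plus_minus_iff F).1 (huniv ▸ Set.mem_univ F) with h | h | ⟨X, hX, hpX, hXM, -⟩
  · exact h1 _ h (hFM _).le (hpM.trans (hFM _).ge)
  · exact h2 _ h (hFM' _).le (hpM'.trans (hFM' _).ge)
  · exact h1 X hX (hXM.trans (hFM _).le) ((hFp _).ge.trans hpX)

theorem HasCanonicalForm.omega_plus_minus_ne_univ (hq : HasCanonicalForm q E) (hn : 3 ≤ n)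
    {M₀ : Submodule K V} (hM₀ : IsTotallySingular q M₀) (hM₀n : Module.finrank K M₀ = n)
    (hK₀ : K₀ ≠ ⊤) :
    (geometryD hn q M₀).Omega E K₀ {DNode.plus, DNode.minus} ≠ Set.univ := by
  intro huniv
  obtain ⟨F, p, M, M', -, hFM, hFM', hpM, hpM', h1, h2, h3⟩ :=
    hq.exists_flag hn hM₀ hM₀n hK₀ (J := {DNode.plus, DNode.minus}) (Set.subset_insert _ _)
  rcases (mem_omega_plus_minus_iff E F).1 (huniv ▸ Set.mem_univ F) with h | h | ⟨X, hX, hXd, hXM, hXM'⟩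
  -- A rational maximal element would itself be a rational subspace containing `p`.
  · exact h1 _ h (hFM _).le (hpM.trans (hFM _).ge)
  · exact h2 _ h (hFM' _).le (hpM'.trans (hFM' _).ge)
  · exact h3 X hX (hXM.trans (hFM _).le) (hXM'.trans (hFM' _).le) hXd

end TypeD

theorem theorem3p3 :
    (∀ (K : Type u) [DivisionRing K] (K₀ : Subfield K) (_ : K₀ ≠ ⊤)
      (V : Type v) [AddCommGroup V] [Module K V] (n : ℕ) (hn : 3 ≤ n)
      (E : Module.Basis (Fin (n + 1)) K V),
      ((geometryA K V n).Gr (typesA hn)).IsProperSubspace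
        ((geometryA K V n).Omega E K₀ (typesA hn))) ∧
    (∀ (K : Type u) [Field K] (K₀ : Subfield K) (_ : K₀ ≠ ⊤)
      (V : Type v) [AddCommGroup V] [Module K V] (n : ℕ) (hn : 3 ≤ n)
      (q : QuadraticForm K V) (E : Module.Basis (Fin n × Fin 2) K V) (_ : HasCanonicalForm q E)
      (M₀ : Submodule K V) (_ : IsTotallySingular q M₀) (_ : Module.finrank K M₀ = n)
      (J : Set (DNode n))
      (_ : J = {DNode.one hn, DNode.minus} ∨ J = {DNode.one hn, DNode.plus, DNode.minus} ∨
        J = {DNode.plus, DNode.minus}),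
      ((geometryD hn q M₀).Gr J).IsProperSubspace ((geometryD hn q M₀).Omega E K₀ J)) := by
  refine ⟨fun K _ K₀ hK₀ V _ _ n hn E => ⟨isSubspace_omega_geometryA hn E,
    omega_geometryA_ne_univ hK₀ hn E⟩, fun K _ K₀ hK₀ V _ _ n hn q E hq M₀ hM₀ hM₀n J hJ => ?_⟩
  rcases hJ with rfl | rfl | rfl
  · exact ⟨hq.isSubspace_omega_one_minus hM₀ hM₀n, hq.omega_one_minus_ne_univ hn hM₀ hM₀n hK₀⟩
  · exact ⟨hq.isSubspace_omega_one_plus_minus hM₀ hM₀n,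
      hq.omega_one_plus_minus_ne_univ hn hM₀ hM₀n hK₀⟩
  · exact ⟨hq.isSubspace_omega_plus_minus hM₀ hM₀n,
      hq.omega_plus_minus_ne_univ hn hM₀ hM₀n hK₀⟩
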